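/- **Setting.** Throughout, the upper and the lower sign in $\mp$ give two separate assertions. Let $\mathbf R^-=(-\infty,0)$, $\mathbf R^+=(0,\infty)$, let $\beta\in(0,\infty]$, and put $I^-=(-\beta,0)$, $I^+=(0,\beta)$. Let $c\ge 0$, with $c>0$ if $\beta=\infty$, and let $\mathbf H^\mp$ be the complex Hilbert space $L^2(I^\mp,e^{-2c|t|}dt)$ (for $c=0$ this is $L^2(I^\mp)$). On $\mathbf H^\mp$ consider the bounded operators $$(\mathcal J^-g)(t)=\int_t^0 g(\tau)\,d\tau\quad(t\in I^-),\qquad (\mathcal J^+g)(t)=\int_0^t g(\tau)\,d\tau\quad(t\in I^+).$$ Let $\varepsilon>0$ and let $k=k^\mp:\mathbf R\to\mathbf R$ be measurable with $\int_{\mathbf R}|k(x)|^2e^{\varepsilon|x|}dx<\infty$, vanishing on $\mathbf R^\pm$, with Fourier transform $\widehat{k}(x)=\int_{\mathbf R}e^{ixy}k(y)\,dy$. For a bounded operator $A$ on $\mathbf H^\mp$ with spectrum in $\{\mp\operatorname{Im}z>0\}$ put $$\widehat{k}(A)=\mp\frac1{2\pi i}\int_{\mathbf R}\widehat{k}(y)\,(yI-A)^{-1}\,dy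 ,$$ and let $\widehat{k}(\mp i/\mathcal J^\mp)$ denote the strong limit, as $\delta\to0^+$, of the operators $\widehat{k}\bigl(\mp i(\mathcal J^\mp+\delta I)^{-1}\bigr)$. Let $1/\mathcal J^\mp$ be the inverse of $\mathcal J^\mp$, defined on the range of $\mathcal J^\mp$. **Theorem 4.2 (Fourier inversion).** Suppose in addition that $k^\mp$ is differentiable at every point of $\mathbf R^\mp$. Then $\mathcal J^\mp$ is injective; for every $\delta>0$ the operator $\mathcal J^\mp+\delta I$ is invertible, the spectrum of $\mp i(\mathcal J^\mp+\delta I)^{-1}$ lies in $\{\mp\operatorname{Im}z>0\}$, and the integral defining $\widehat{k^\mp}\bigl(\mp i(\mathcal J^\mp+\delta I)^{-1}\bigr)$ converges absolutely in operator norm; the strong limit $\widehat{k^\mp}(\mp i/\mathcal J^\mp)$ exists as a bounded operator on $\mathbf H^\mp$; the function $\widehat{k^\mp}(\mp i/\mathcal J^\mp)\,1$ belongs to the range of $\mathcal J^\mp$; and $$k^\mp=\bigl(1/\mathcal J^\mp\bigr)\,\widehat{k^\mp}\bigl(\mp i/\mathcal J^\mp\bigr)\,1\qquad\text{in }\mathbf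 H^\mp,$$ where $1$ is the function that is identically $1$. Moreover $\widehat{k^\mp}(\mp i/\mathcal J^\mp)\,1$ has a representative $F$ that is differentiable on $I^\mp$, and $k^\mp(t)=\mp F'(t)$ for every $t\in I^\mp$. -/

import Mathlib

open MeasureTheory Filter Topology
open scoped ENNReal

namespace FourierInv

/-- The two signs of the paired notation `∓`: `minus` is the upper sign, `plus` the lower one. -/
inductive Side where
  | minus
  | plus

/-- `-1` for the upper sign of `∓` and `+1` for the lower one. -/
def Side.sgn : Side → ℝ
  | .minus => -1
  | .plus => 1

/-- The open half line `ℝ⁻ = (-∞, 0)` or `ℝ⁺ = (0, ∞)`. -/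
def halfLine : Side → Set ℝ
  | .minus => Set.Iio 0
  | .plus => Set.Ioi 0

/-- The supports of `𝒥⁻` and of `𝒥⁺`: the intervals `(-β, 0)` and `(0, β)`, `β ∈ (0, ∞]`. -/
def supp : Side → EReal → Set ℝ
  | .minus, β => {t : ℝ | -β < (t : EReal) ∧ t < 0}
  | .plus, β => {t : ℝ | 0 < t ∧ (t : EReal) < β}

/-- Indefinite integration: from `t` up to the right end `0` of `(-β, 0)`, respectively from the
left end `0` of `(0, β)` up to `t`. -/
noncomputable def indefInt : Side → (ℝ → ℂ) → ℝ → ℂ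
  | .minus, g, t => ∫ τ in t..(0 : ℝ), g τ
  | .plus, g, t => ∫ τ in (0 : ℝ)..t, g τ

/-- The measure `exp (-2 c |t|) dt` on the support. For `c = 0` this is Lebesgue measure. -/
noncomputable def wMeasure (s : Side) (β : EReal) (c : ℝ) : Measure ℝ :=
  (volume.restrict (supp s β)).withDensity (fun t => ENNReal.ofReal (Real.exp (-(2 * c * |t|))))

/-- The Hilbert space on which `𝒥^∓` acts: `L²` of the support, with the weight
`exp (-2 c |t|)`. -/
abbrev HSpace (s : Side) (β : EReal) (c : ℝ) : Type := Lp ℂ 2 (wMeasure s β c)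

/-- The weights for which indefinite integration is bounded: any `c ≥ 0` on a bounded interval
(`c = 0` being the unweighted space), and `c > 0` on a half line. -/
def Admissible (β : EReal) (c : ℝ) : Prop := 0 ≤ c ∧ (β = ⊤ → 0 < c)

/-! ### Boundedness of indefinite integration -/

/-- The open interval between `0` and `t`, on the given side. -/
def seg : Side → ℝ → Set ℝ
  | .minus, t => Set.Ioo t 0
  | .plus, t => Set.Ioo 0 t

theorem measurableSet_supp (s : Side) (β : EReal) : MeasurableSet (supp s β) := by
  cases s
  · exact (measurableSet_lt measurable_const measurable_coe_real_ereal).inter measurableSet_Iio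
  · exact measurableSet_Ioi.inter (measurableSet_lt measurable_coe_real_ereal measurable_const)

theorem measurableSet_seg (s : Side) (t : ℝ) : MeasurableSet (seg s t) := by
  cases s <;> exact measurableSet_Ioo

theorem measurableSet_seg_prod (s : Side) : MeasurableSet {p : ℝ × ℝ | p.2 ∈ seg s p.1} := by
  cases s
  · exact (measurableSet_lt measurable_fst measurable_snd).inter
      (measurableSet_lt measurable_snd measurable_const)
  · exact (measurableSet_lt measurable_const measurable_snd).inter
      (measurableSet_lt measurable_snd measurable_fst)

theorem seg_subset {s : Side} {β : EReal} {t : ℝ} (ht : t ∈ supp s β) : seg s t ⊆ supp s β := by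
  cases s
  · intro τ hτ
    exact ⟨ht.1.trans (EReal.coe_lt_coe_iff.2 hτ.1), hτ.2⟩
  · intro τ hτ
    exact ⟨hτ.1, (EReal.coe_lt_coe_iff.2 hτ.2).trans ht.2⟩

theorem abs_le_of_mem_seg {s : Side} {t τ : ℝ} (h : τ ∈ seg s t) : |τ| ≤ |t| := by
  cases s
  · obtain ⟨h1, h2⟩ := h
    rw [abs_of_neg h2, abs_of_neg (h1.trans h2)]; linarith
  · obtain ⟨h1, h2⟩ := h
    rw [abs_of_pos h1, abs_of_pos (h1.trans h2)]; linarith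

theorem indefInt_eq {s : Side} {β : EReal} {t : ℝ} (ht : t ∈ supp s β) (g : ℝ → ℂ) :
    indefInt s g t = ∫ τ in seg s t, g τ := by
  cases s
  · simp only [indefInt, seg]
    rw [intervalIntegral.integral_of_le ht.2.le, integral_Ioc_eq_integral_Ioo]
  · simp only [indefInt, seg]
    rw [intervalIntegral.integral_of_le ht.1.le, integral_Ioc_eq_integral_Ioo]

theorem volume_seg_lt_top (s : Side) (t : ℝ) : volume (seg s t) < ⊤ := by
  cases s <;> simp [seg]

theorem measurable_weight (c : ℝ) :
    Measurable (fun t : ℝ => ENNReal.ofReal (Real.exp (-(2 * c * |t|)))) := by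
  fun_prop

theorem lintegral_wMeasure (s : Side) (β : EReal) (c : ℝ) {f : ℝ → ℝ≥0∞} (hf : Measurable f) :
    ∫⁻ t, f t ∂(wMeasure s β c) =
      ∫⁻ t in supp s β, ENNReal.ofReal (Real.exp (-(2 * c * |t|))) * f t := by
  rw [wMeasure, lintegral_withDensity_eq_lintegral_mul _ (measurable_weight c) hf]
  rfl

theorem ae_wMeasure_mem (s : Side) (β : EReal) (c : ℝ) :
    ∀ᵐ t ∂(wMeasure s β c), t ∈ supp s β :=
  (withDensity_absolutelyContinuous _ _).ae_le (ae_restrict_mem (measurableSet_supp s β))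

theorem ae_wMeasure_iff (s : Side) (β : EReal) (c : ℝ) {p : ℝ → Prop} :
    (∀ᵐ t ∂(wMeasure s β c), p t) ↔ ∀ᵐ t ∂(volume.restrict (supp s β)), p t := by
  rw [wMeasure, ae_withDensity_iff (measurable_weight c)]
  simp [Real.exp_pos]

/-- Square integrable functions are integrable between `0` and any point of the support. -/
theorem integrableOn_seg {s : Side} {β : EReal} {c : ℝ} {t : ℝ}
    (ht : t ∈ supp s β) {g : ℝ → ℂ} (hg : MemLp g 2 (wMeasure s β c)) :
    IntegrableOn g (seg s t) := by
  set C : ℝ := Real.exp (2 * |c| * |t|)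
  have hle : volume.restrict (seg s t) ≤ ENNReal.ofReal C • wMeasure s β c := by
    refine Measure.le_iff.2 fun A hA => ?_
    rw [Measure.restrict_apply hA, Measure.smul_apply, smul_eq_mul, wMeasure,
      withDensity_apply _ hA, Measure.restrict_restrict hA,
      ← lintegral_const_mul _ (measurable_weight c)]
    calc volume (A ∩ seg s t) = ∫⁻ _ in A ∩ seg s t, 1 := by simp
      _ ≤ ∫⁻ τ in A ∩ seg s t,
            ENNReal.ofReal C * ENNReal.ofReal (Real.exp (-(2 * c * |τ|))) := by
          refine setLIntegral_mono' (hA.inter (measurableSet_seg s t)) fun τ hτ => ?_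
          rw [← ENNReal.ofReal_mul (Real.exp_pos _).le, ← Real.exp_add]
          rw [← ENNReal.ofReal_one]
          refine ENNReal.ofReal_le_ofReal (Real.one_le_exp ?_)
          have h1 := abs_le_of_mem_seg hτ.2
          have h2 : c * |τ| ≤ |c| * |t| :=
            mul_le_mul (le_abs_self c) h1 (abs_nonneg _) (abs_nonneg _)
          linarith
      _ ≤ _ := lintegral_mono_set (Set.inter_subset_inter_right _ (seg_subset ht))
  have h2 : MemLp g 2 (volume.restrict (seg s t)) :=
    (hg.smul_measure ENNReal.ofReal_ne_top).mono_measure hle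
  have : IsFiniteMeasure (volume.restrict (seg s t)) :=
    ⟨by simpa using volume_seg_lt_top s t⟩
  exact h2.integrable (by norm_num)

theorem lintegral_seg_exp_le (s : Side) {γ : ℝ} (hγ : 0 < γ) {t : ℝ} (ht : t ∈ halfLine s) :
    ∫⁻ τ in seg s t, ENNReal.ofReal (Real.exp (γ * |τ|)) ≤
      ENNReal.ofReal (Real.exp (γ * |t|) / γ) := by
  cases s
  · have ht' : t < 0 := ht
    calc ∫⁻ τ in seg .minus t, ENNReal.ofReal (Real.exp (γ * |τ|))
        = ∫⁻ τ in seg .minus t, ENNReal.ofReal (Real.exp ((-γ) * τ)) := by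
          refine setLIntegral_congr_fun (measurableSet_seg _ _) fun τ hτ => ?_
          simp only [abs_of_neg hτ.2, mul_neg, neg_mul]
      _ ≤ ∫⁻ τ in Set.Ioi t, ENNReal.ofReal (Real.exp ((-γ) * τ)) :=
          lintegral_mono_set fun τ hτ => hτ.1
      _ = ENNReal.ofReal (Real.exp (γ * |t|) / γ) := by
          rw [← ofReal_integral_eq_lintegral_ofReal (integrableOn_exp_mul_Ioi (by linarith) _)
            (ae_of_all _ fun _ => (Real.exp_pos _).le), integral_exp_mul_Ioi (by linarith),
            abs_of_neg ht']
          congr 1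
          rw [neg_div_neg_eq, mul_neg, neg_mul]
  · have ht' : 0 < t := ht
    calc ∫⁻ τ in seg .plus t, ENNReal.ofReal (Real.exp (γ * |τ|))
        = ∫⁻ τ in seg .plus t, ENNReal.ofReal (Real.exp (γ * τ)) := by
          refine setLIntegral_congr_fun (measurableSet_seg _ _) fun τ hτ => ?_
          simp only [abs_of_pos hτ.1]
      _ ≤ ∫⁻ τ in Set.Iic t, ENNReal.ofReal (Real.exp (γ * τ)) :=
          lintegral_mono_set fun τ hτ => hτ.2.le
      _ = ENNReal.ofReal (Real.exp (γ * |t|) / γ) := by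
          rw [← ofReal_integral_eq_lintegral_ofReal (integrableOn_exp_mul_Iic hγ _)
            (ae_of_all _ fun _ => (Real.exp_pos _).le), integral_exp_mul_Iic hγ, abs_of_pos ht']

theorem lintegral_exp_neg_le (s : Side) {γ : ℝ} (hγ : 0 < γ) {τ : ℝ} :
    ∫⁻ t in {t | τ ∈ seg s t}, ENNReal.ofReal (Real.exp (-(γ * |t|))) ≤
      ENNReal.ofReal (Real.exp (-(γ * |τ|)) / γ) := by
  cases s
  · have hm : MeasurableSet {t | τ ∈ seg .minus t} :=
      measurable_prodMk_right (measurableSet_seg_prod .minus)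
    by_cases hτ : τ < 0
    · calc ∫⁻ t in {t | τ ∈ seg .minus t}, ENNReal.ofReal (Real.exp (-(γ * |t|)))
          = ∫⁻ t in {t | τ ∈ seg .minus t}, ENNReal.ofReal (Real.exp (γ * t)) := by
            refine setLIntegral_congr_fun hm fun t ht => ?_
            have : t < 0 := ht.1.trans hτ
            simp only [abs_of_neg this, mul_neg, neg_neg]
        _ ≤ ∫⁻ t in Set.Iic τ, ENNReal.ofReal (Real.exp (γ * t)) :=
            lintegral_mono_set fun t ht => ht.1.le
        _ = _ := by
            rw [← ofReal_integral_eq_lintegral_ofReal (integrableOn_exp_mul_Iic hγ _)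
              (ae_of_all _ fun _ => (Real.exp_pos _).le), integral_exp_mul_Iic hγ,
              abs_of_neg hτ, mul_neg, neg_neg]
    · have : {t | τ ∈ seg .minus t} = ∅ := by
        ext t; simp only [seg, Set.mem_Ioo, Set.mem_ofPred_eq, Set.mem_empty_iff_false]; tauto
      simp [this]
  · have hm : MeasurableSet {t | τ ∈ seg .plus t} :=
      measurable_prodMk_right (measurableSet_seg_prod .plus)
    by_cases hτ : 0 < τ
    · calc ∫⁻ t in {t | τ ∈ seg .plus t}, ENNReal.ofReal (Real.exp (-(γ * |t|)))
          = ∫⁻ t in {t | τ ∈ seg .plus t}, ENNReal.ofReal (Real.exp ((-γ) * t)) := by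
            refine setLIntegral_congr_fun hm fun t ht => ?_
            have : 0 < t := hτ.trans ht.2
            simp only [abs_of_pos this, neg_mul]
        _ ≤ ∫⁻ t in Set.Ioi τ, ENNReal.ofReal (Real.exp ((-γ) * t)) :=
            lintegral_mono_set fun t ht => ht.2
        _ = _ := by
            rw [← ofReal_integral_eq_lintegral_ofReal (integrableOn_exp_mul_Ioi (by linarith) _)
              (ae_of_all _ fun _ => (Real.exp_pos _).le), integral_exp_mul_Ioi (by linarith),
              abs_of_pos hτ, neg_div_neg_eq, neg_mul]
    · have : {t | τ ∈ seg .plus t} = ∅ := by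
        ext t; simp only [seg, Set.mem_Ioo, Set.mem_ofPred_eq, Set.mem_empty_iff_false]; tauto
      simp [this]

theorem supp_subset_halfLine (s : Side) (β : EReal) : supp s β ⊆ halfLine s := by
  cases s
  · exact fun t ht => ht.2
  · exact fun t ht => ht.1

/-- Schur test, with a weight `exp (-γ |τ|)`. -/
theorem schur (s : Side) (β : EReal) (c : ℝ) {γ : ℝ} (hγ : 0 < γ) {C : ℝ≥0∞}
    (hC : ∀ τ ∈ supp s β,
      ∫⁻ t in supp s β ∩ {t | τ ∈ seg s t},
        ENNReal.ofReal (Real.exp (-(2 * c * |t|))) * ENNReal.ofReal (Real.exp (γ * |t|) / γ) ≤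
      C * ENNReal.ofReal (Real.exp (-(2 * c * |τ|)) * Real.exp (γ * |τ|)))
    {φ : ℝ → ℝ≥0∞} (hφ : Measurable φ) :
    ∫⁻ t, (∫⁻ τ in seg s t, φ τ) ^ 2 ∂(wMeasure s β c) ≤
      C * ∫⁻ τ, φ τ ^ 2 ∂(wMeasure s β c) := by
  have hSm := measurableSet_supp s β
  let ψ : ℝ → ℝ≥0∞ := fun τ => φ τ ^ 2 * ENNReal.ofReal (Real.exp (-(γ * |τ|)))
  have hψ : Measurable ψ := by
    apply (hφ.pow_const 2).mul; fun_prop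
  have hcs : ∀ t ∈ supp s β, (∫⁻ τ in seg s t, φ τ) ^ 2 ≤
      ENNReal.ofReal (Real.exp (γ * |t|) / γ) * ∫⁻ τ in seg s t, ψ τ := by
    intro t ht
    have h := ENNReal.lintegral_mul_le_Lp_mul_Lq (volume.restrict (seg s t))
      (p := 2) (q := 2) (by constructor <;> norm_num)
      (f := fun τ => φ τ * ENNReal.ofReal (Real.exp (-(γ * |τ| / 2))))
      (g := fun τ => ENNReal.ofReal (Real.exp (γ * |τ| / 2)))
      (by apply Measurable.aemeasurable; apply hφ.mul; fun_prop)
      (by apply Measurable.aemeasurable; fun_prop)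
    have e1 : ∀ τ : ℝ, (φ τ * ENNReal.ofReal (Real.exp (-(γ * |τ| / 2)))) *
        ENNReal.ofReal (Real.exp (γ * |τ| / 2)) = φ τ := by
      intro τ
      rw [mul_assoc, ← ENNReal.ofReal_mul (Real.exp_pos _).le, ← Real.exp_add]
      simp
    have e2 : ∀ τ : ℝ, (φ τ * ENNReal.ofReal (Real.exp (-(γ * |τ| / 2)))) ^ (2 : ℝ) = ψ τ := by
      intro τ
      rw [ENNReal.rpow_two, mul_pow, ← ENNReal.ofReal_pow (Real.exp_pos _).le, ← Real.exp_nat_mul]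
      simp only [ψ]
      congr 3
      push_cast; ring
    have e3 : ∀ τ : ℝ, (ENNReal.ofReal (Real.exp (γ * |τ| / 2))) ^ (2 : ℝ) =
        ENNReal.ofReal (Real.exp (γ * |τ|)) := by
      intro τ
      rw [ENNReal.rpow_two, ← ENNReal.ofReal_pow (Real.exp_pos _).le, ← Real.exp_nat_mul]
      congr 2
      push_cast; ring
    simp only [Pi.mul_apply, e1, e2, e3] at h
    calc (∫⁻ τ in seg s t, φ τ) ^ 2
        ≤ ((∫⁻ τ in seg s t, ψ τ) ^ (1 / (2 : ℝ)) *
            (∫⁻ τ in seg s t, ENNReal.ofReal (Real.exp (γ * |τ|))) ^ (1 / (2 : ℝ))) ^ 2 := by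
          gcongr
      _ = (∫⁻ τ in seg s t, ψ τ) *
            (∫⁻ τ in seg s t, ENNReal.ofReal (Real.exp (γ * |τ|))) := by
          rw [mul_pow, ← ENNReal.rpow_two, ← ENNReal.rpow_two, ← ENNReal.rpow_mul,
            ← ENNReal.rpow_mul]
          norm_num
      _ ≤ (∫⁻ τ in seg s t, ψ τ) * ENNReal.ofReal (Real.exp (γ * |t|) / γ) := by
          gcongr
          exact lintegral_seg_exp_le s hγ (supp_subset_halfLine s β ht)
      _ = _ := mul_comm _ _
  let K : ℝ → ℝ → ℝ≥0∞ := fun t τ => {p : ℝ × ℝ | p.2 ∈ seg s p.1}.indicator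
    (fun p => ENNReal.ofReal (Real.exp (-(2 * c * |p.1|))) *
      ENNReal.ofReal (Real.exp (γ * |p.1|) / γ) * ψ p.2) (t, τ)
  have hK : Measurable (Function.uncurry K) := by
    have : Measurable ({p : ℝ × ℝ | p.2 ∈ seg s p.1}.indicator
      (fun p => ENNReal.ofReal (Real.exp (-(2 * c * |p.1|))) *
      ENNReal.ofReal (Real.exp (γ * |p.1|) / γ) * ψ p.2)) := by
      refine Measurable.indicator ?_ (measurableSet_seg_prod s)
      refine Measurable.mul (by fun_prop) (hψ.comp measurable_snd)
    exact this
  have hinner : Measurable (fun t => ∫⁻ τ in seg s t, φ τ) := by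
    have : Measurable ({p : ℝ × ℝ | p.2 ∈ seg s p.1}.indicator (fun p => φ p.2)) :=
      (hφ.comp measurable_snd).indicator (measurableSet_seg_prod s)
    have h2 := this.lintegral_prod_right' (ν := volume)
    convert h2 using 2 with t
    rw [← lintegral_indicator (measurableSet_seg s t)]
    rfl
  rw [lintegral_wMeasure _ _ _ (hinner.pow_const 2),
    lintegral_wMeasure _ _ _ (hφ.pow_const 2)]
  calc ∫⁻ t in supp s β, ENNReal.ofReal (Real.exp (-(2 * c * |t|))) *
          (∫⁻ τ in seg s t, φ τ) ^ 2
      ≤ ∫⁻ t in supp s β, ∫⁻ τ in supp s β, K t τ := by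
        refine setLIntegral_mono' hSm fun t ht => ?_
        calc _ ≤ ENNReal.ofReal (Real.exp (-(2 * c * |t|))) *
              (ENNReal.ofReal (Real.exp (γ * |t|) / γ) * ∫⁻ τ in seg s t, ψ τ) := by
              gcongr; exact hcs t ht
          _ = ∫⁻ τ in seg s t, ENNReal.ofReal (Real.exp (-(2 * c * |t|))) *
              ENNReal.ofReal (Real.exp (γ * |t|) / γ) * ψ τ := by
              rw [lintegral_const_mul _ hψ, mul_assoc (ENNReal.ofReal (Real.exp (-(2 * c * |t|))))]
          _ = ∫⁻ τ in seg s t, K t τ := by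
              refine setLIntegral_congr_fun (measurableSet_seg s t) fun τ hτ => ?_
              have : (t, τ) ∈ {p : ℝ × ℝ | p.2 ∈ seg s p.1} := hτ
              simp only [K, Set.indicator_of_mem this]
          _ ≤ _ := lintegral_mono_set (seg_subset ht)
    _ = ∫⁻ τ in supp s β, ∫⁻ t in supp s β, K t τ :=
        lintegral_lintegral_swap hK.aemeasurable
    _ ≤ ∫⁻ τ in supp s β, C * (ENNReal.ofReal (Real.exp (-(2 * c * |τ|))) * φ τ ^ 2) := by
        refine setLIntegral_mono' hSm fun τ hτ => ?_
        have hm : MeasurableSet {t | τ ∈ seg s t} :=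
          measurable_prodMk_right (measurableSet_seg_prod s)
        calc ∫⁻ t in supp s β, K t τ
            = ∫⁻ t in supp s β ∩ {t | τ ∈ seg s t}, ENNReal.ofReal (Real.exp (-(2 * c * |t|))) *
              ENNReal.ofReal (Real.exp (γ * |t|) / γ) * ψ τ := by
              rw [Set.inter_comm, ← Measure.restrict_restrict hm, ← lintegral_indicator hm]
              rfl
          _ = (∫⁻ t in supp s β ∩ {t | τ ∈ seg s t}, ENNReal.ofReal (Real.exp (-(2 * c * |t|))) *
              ENNReal.ofReal (Real.exp (γ * |t|) / γ)) * ψ τ := by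
              rw [lintegral_mul_const]; fun_prop
          _ ≤ C * ENNReal.ofReal (Real.exp (-(2 * c * |τ|)) * Real.exp (γ * |τ|)) * ψ τ := by
              gcongr; exact hC τ hτ
          _ = _ := by
              simp only [ψ]
              rw [ENNReal.ofReal_mul (Real.exp_pos _).le]
              have : ENNReal.ofReal (Real.exp (γ * |τ|)) *
                  ENNReal.ofReal (Real.exp (-(γ * |τ|))) = 1 := by
                rw [← ENNReal.ofReal_mul (Real.exp_pos _).le, ← Real.exp_add]; simp
              calc _ = C * (ENNReal.ofReal (Real.exp (-(2 * c * |τ|))) * φ τ ^ 2) *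
                  (ENNReal.ofReal (Real.exp (γ * |τ|)) *
                  ENNReal.ofReal (Real.exp (-(γ * |τ|)))) := by ring
                _ = _ := by rw [this, mul_one]
    _ = _ := by
        rw [lintegral_const_mul]
        exact (measurable_weight c).mul (hφ.pow_const 2)

theorem exists_bound (s : Side) {β : EReal} {c : ℝ} (h : Admissible β c) :
    ∃ C : ℝ≥0∞, C ≠ ⊤ ∧ ∀ φ : ℝ → ℝ≥0∞, Measurable φ →
      ∫⁻ t, (∫⁻ τ in seg s t, φ τ) ^ 2 ∂(wMeasure s β c) ≤
        C * ∫⁻ τ, φ τ ^ 2 ∂(wMeasure s β c) := by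
  rcases h.1.eq_or_lt with hc | hc
  · -- unweighted case, on a bounded interval
    have hβ : β ≠ ⊤ := fun hb => absurd (h.2 hb) (by rw [← hc]; exact lt_irrefl _)
    obtain ⟨b, hb⟩ : ∃ b : ℝ, ∀ t ∈ supp s β, |t| ≤ b := by
      induction β with
      | top => exact absurd rfl hβ
      | bot => exact ⟨0, by cases s <;> simp [supp]⟩
      | coe b =>
        refine ⟨b, fun t ht => ?_⟩
        cases s
        · have h1 : -b < t := by
            have := ht.1
            rw [← EReal.coe_neg] at this
            exact EReal.coe_lt_coe_iff.1 this
          rw [abs_of_neg ht.2]; linarith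
        · have h1 : t < b := EReal.coe_lt_coe_iff.1 ht.2
          rw [abs_of_pos ht.1]; exact h1.le
    have hvol : volume (supp s β) ≤ ENNReal.ofReal (2 * b) := by
      calc volume (supp s β) ≤ volume (Set.Icc (-b) b) :=
            measure_mono fun t ht => abs_le.1 (hb t ht)
        _ = _ := by rw [Real.volume_Icc]; congr 1; ring
    refine ⟨ENNReal.ofReal (Real.exp b) * ENNReal.ofReal (2 * b),
      ENNReal.mul_ne_top ENNReal.ofReal_ne_top ENNReal.ofReal_ne_top,
      fun φ hφ => schur s β c one_pos (fun τ hτ => ?_) hφ⟩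
    subst hc
    simp only [mul_zero, zero_mul, neg_zero, Real.exp_zero, ENNReal.ofReal_one, one_mul, div_one]
    calc ∫⁻ t in supp s β ∩ {t | τ ∈ seg s t}, ENNReal.ofReal (Real.exp |t|)
        ≤ ∫⁻ t in supp s β, ENNReal.ofReal (Real.exp |t|) :=
          lintegral_mono_set Set.inter_subset_left
      _ ≤ ∫⁻ _ in supp s β, ENNReal.ofReal (Real.exp b) :=
          setLIntegral_mono' (measurableSet_supp s β) fun t ht =>
            ENNReal.ofReal_le_ofReal (Real.exp_le_exp.2 (hb t ht))
      _ = ENNReal.ofReal (Real.exp b) * volume (supp s β) := by simp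
      _ ≤ ENNReal.ofReal (Real.exp b) * ENNReal.ofReal (2 * b) * 1 := by
          rw [mul_one]; gcongr
      _ ≤ _ := by
          gcongr
          rw [← ENNReal.ofReal_one]
          exact ENNReal.ofReal_le_ofReal (Real.one_le_exp (abs_nonneg _))
  · refine ⟨ENNReal.ofReal (1 / c ^ 2), ENNReal.ofReal_ne_top,
      fun φ hφ => schur s β c hc (fun τ hτ => ?_) hφ⟩
    calc _ = ∫⁻ t in supp s β ∩ {t | τ ∈ seg s t},
            ENNReal.ofReal (1 / c) * ENNReal.ofReal (Real.exp (-(c * |t|))) := by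
          congr 1
          ext t
          rw [← ENNReal.ofReal_mul (Real.exp_pos _).le,
            ← ENNReal.ofReal_mul (by positivity), mul_div_assoc', ← Real.exp_add,
            one_div_mul_eq_div]
          congr 3; ring
      _ ≤ ∫⁻ t in {t | τ ∈ seg s t},
            ENNReal.ofReal (1 / c) * ENNReal.ofReal (Real.exp (-(c * |t|))) :=
          lintegral_mono_set Set.inter_subset_right
      _ = ENNReal.ofReal (1 / c) * ∫⁻ t in {t | τ ∈ seg s t},
            ENNReal.ofReal (Real.exp (-(c * |t|))) := by
          rw [lintegral_const_mul]; fun_prop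
      _ ≤ ENNReal.ofReal (1 / c) * ENNReal.ofReal (Real.exp (-(c * |τ|)) / c) := by
          gcongr; exact lintegral_exp_neg_le s hc
      _ = _ := by
          rw [← ENNReal.ofReal_mul (by positivity), ← ENNReal.ofReal_mul (by positivity),
            ← Real.exp_add]
          congr 1
          rw [show -(2 * c * |τ|) + c * |τ| = -(c * |τ|) by ring]
          field_simp

theorem aestronglyMeasurable_indefInt (s : Side) (β : EReal) (c : ℝ) {g : ℝ → ℂ}
    (hg : StronglyMeasurable g) :
    AEStronglyMeasurable (indefInt s g) (wMeasure s β c) := by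
  have h1 : StronglyMeasurable ({p : ℝ × ℝ | p.2 ∈ seg s p.1}.indicator (fun p => g p.2)) :=
    (hg.comp_measurable measurable_snd).indicator (measurableSet_seg_prod s)
  have h2 := h1.integral_prod_right' (ν := volume)
  refine ⟨_, h2, ?_⟩
  filter_upwards [ae_wMeasure_mem s β c] with t ht
  rw [indefInt_eq ht, ← integral_indicator (measurableSet_seg s t)]
  rfl

theorem eLpNorm_indefInt_le (s : Side) {β : EReal} {c : ℝ} {C : ℝ≥0∞}
    (hC : ∀ φ : ℝ → ℝ≥0∞, Measurable φ →
      ∫⁻ t, (∫⁻ τ in seg s t, φ τ) ^ 2 ∂(wMeasure s β c) ≤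
        C * ∫⁻ τ, φ τ ^ 2 ∂(wMeasure s β c))
    {g : ℝ → ℂ} (hg : StronglyMeasurable g) :
    eLpNorm (indefInt s g) 2 (wMeasure s β c) ≤
      C ^ (1 / (2 : ℝ)) * eLpNorm g 2 (wMeasure s β c) := by
  rw [eLpNorm_eq_lintegral_rpow_enorm_toReal (by norm_num) (by norm_num),
    eLpNorm_eq_lintegral_rpow_enorm_toReal (by norm_num) (by norm_num),
    ENNReal.toReal_ofNat, ← ENNReal.mul_rpow_of_nonneg _ _ (by norm_num)]
  simp only [ENNReal.rpow_two]
  gcongr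
  refine le_trans (lintegral_mono_ae ?_) (hC (fun τ => ‖g τ‖ₑ) hg.enorm)
  filter_upwards [ae_wMeasure_mem s β c] with t ht
  rw [indefInt_eq ht]
  gcongr
  exact enorm_integral_le_lintegral_enorm _

theorem memLp_indefInt (s : Side) {β : EReal} {c : ℝ} (h : Admissible β c)
    (g : HSpace s β c) : MemLp (indefInt s g) 2 (wMeasure s β c) := by
  obtain ⟨C, hC, hb⟩ := exists_bound s h
  refine ⟨aestronglyMeasurable_indefInt s β c (Lp.stronglyMeasurable g),
    (eLpNorm_indefInt_le s hb (Lp.stronglyMeasurable g)).trans_lt ?_⟩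
  exact ENNReal.mul_lt_top (ENNReal.rpow_lt_top_of_nonneg (by norm_num) hC) (Lp.memLp g).2

theorem indefInt_congr {s : Side} {β : EReal} {c : ℝ} {f g : ℝ → ℂ}
    (hfg : f =ᵐ[wMeasure s β c] g) {t : ℝ} (ht : t ∈ supp s β) :
    indefInt s f t = indefInt s g t := by
  rw [indefInt_eq ht, indefInt_eq ht]
  exact integral_congr_ae
    (ae_mono (Measure.restrict_mono (seg_subset ht) le_rfl) ((ae_wMeasure_iff s β c).1 hfg))

/-- Indefinite integration as a linear map. -/
noncomputable def JLin (s : Side) (β : EReal) (c : ℝ) (h : Admissible β c) :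
    HSpace s β c →ₗ[ℂ] HSpace s β c where
  toFun g := (memLp_indefInt s h g).toLp _
  map_add' f g := by
    rw [← MemLp.toLp_add, MemLp.toLp_eq_toLp_iff]
    filter_upwards [ae_wMeasure_mem s β c] with t ht
    rw [indefInt_congr (Lp.coeFn_add f g) ht, Pi.add_apply, indefInt_eq ht, indefInt_eq ht,
      indefInt_eq ht]
    exact integral_add (integrableOn_seg ht (Lp.memLp f)) (integrableOn_seg ht (Lp.memLp g))
  map_smul' a g := by
    rw [RingHom.id_apply, ← MemLp.toLp_const_smul, MemLp.toLp_eq_toLp_iff]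
    filter_upwards [ae_wMeasure_mem s β c] with t ht
    rw [indefInt_congr (Lp.coeFn_smul a g) ht, Pi.smul_apply, indefInt_eq ht, indefInt_eq ht]
    exact integral_smul a _

theorem JLin_bound (s : Side) (β : EReal) (c : ℝ) (h : Admissible β c) :
    ∃ C : ℝ, ∀ g : HSpace s β c, ‖JLin s β c h g‖ ≤ C * ‖g‖ := by
  obtain ⟨C, hC, hb⟩ := exists_bound s h
  refine ⟨(C ^ (1 / (2 : ℝ))).toReal, fun g => ?_⟩
  have hfin : C ^ (1 / (2 : ℝ)) ≠ ⊤ := (ENNReal.rpow_lt_top_of_nonneg (by norm_num) hC).ne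
  rw [Lp.norm_def g, ← ENNReal.toReal_mul]
  simp only [JLin, LinearMap.coe_mk, AddHom.coe_mk, Lp.norm_toLp]
  exact ENNReal.toReal_mono (ENNReal.mul_ne_top hfin (Lp.memLp g).2.ne)
    (eLpNorm_indefInt_le s hb (Lp.stronglyMeasurable g))

/-- The bounded operator `𝒥^∓` on the Hilbert space over its support. -/
noncomputable def J (s : Side) (β : EReal) (c : ℝ) (h : Admissible β c) :
    HSpace s β c →L[ℂ] HSpace s β c :=
  (JLin s β c h).mkContinuousOfExistsBound (JLin_bound s β c h)

theorem J_coeFn (s : Side) (β : EReal) (c : ℝ) (h : Admissible β c) (g : HSpace s β c) :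
    J s β c h g =ᵐ[wMeasure s β c] indefInt s g :=
  MemLp.coeFn_toLp (memLp_indefInt s h g)

/-- The operator `1/𝒥^∓`: the (unbounded, partially defined) inverse of `𝒥^∓`, whose domain is the
range of `𝒥^∓`. -/
noncomputable def invJ (s : Side) (β : EReal) (c : ℝ) (h : Admissible β c) :
    HSpace s β c →ₗ.[ℂ] HSpace s β c :=
  ((J s β c h).toLinearMap.toPMap ⊤).inverse

/-! ### The constant function `1` -/

theorem isFiniteMeasure_wMeasure (s : Side) {β : EReal} {c : ℝ} (h : Admissible β c) :
    IsFiniteMeasure (wMeasure s β c) := by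
  refine ⟨?_⟩
  rw [wMeasure, withDensity_apply _ MeasurableSet.univ, Measure.restrict_univ]
  rcases h.1.eq_or_lt with hc | hc
  · have hβ : β ≠ ⊤ := fun hb => absurd (h.2 hb) (by rw [← hc]; exact lt_irrefl _)
    subst hc
    simp only [mul_zero, zero_mul, neg_zero, Real.exp_zero, ENNReal.ofReal_one, lintegral_const,
      one_mul, Measure.restrict_apply MeasurableSet.univ, Set.univ_inter]
    induction β with
    | top => exact absurd rfl hβ
    | bot => cases s <;> simp [supp]
    | coe b =>
      refine (measure_mono (t := Set.Icc (-b) b) fun t ht => ?_).trans_lt measure_Icc_lt_top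
      cases s
      · have h1 : -b < t := by
          have := ht.1
          rw [← EReal.coe_neg] at this
          exact EReal.coe_lt_coe_iff.1 this
        have h2 : t < 0 := ht.2
        exact ⟨h1.le, by linarith⟩
      · have h1 : t < b := EReal.coe_lt_coe_iff.1 ht.2
        have h2 : 0 < t := ht.1
        exact ⟨by linarith, h1.le⟩
  · have h2c : 0 < 2 * c := by linarith
    cases s
    · calc ∫⁻ t in supp .minus β, ENNReal.ofReal (Real.exp (-(2 * c * |t|)))
          = ∫⁻ t in supp .minus β, ENNReal.ofReal (Real.exp ((2 * c) * t)) := by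
            refine setLIntegral_congr_fun (measurableSet_supp _ _) fun t ht => ?_
            simp only [abs_of_neg ht.2, mul_neg, neg_neg]
        _ ≤ ∫⁻ t in Set.Iic 0, ENNReal.ofReal (Real.exp ((2 * c) * t)) :=
            lintegral_mono_set fun t ht => ht.2.le
        _ < ⊤ := by
            rw [← ofReal_integral_eq_lintegral_ofReal (integrableOn_exp_mul_Iic h2c _)
              (ae_of_all _ fun _ => (Real.exp_pos _).le)]
            exact ENNReal.ofReal_lt_top
    · calc ∫⁻ t in supp .plus β, ENNReal.ofReal (Real.exp (-(2 * c * |t|)))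
          = ∫⁻ t in supp .plus β, ENNReal.ofReal (Real.exp ((-(2 * c)) * t)) := by
            refine setLIntegral_congr_fun (measurableSet_supp _ _) fun t ht => ?_
            simp only [abs_of_pos ht.1, neg_mul]
        _ ≤ ∫⁻ t in Set.Ioi 0, ENNReal.ofReal (Real.exp ((-(2 * c)) * t)) :=
            lintegral_mono_set fun t ht => ht.1
        _ < ⊤ := by
            rw [← ofReal_integral_eq_lintegral_ofReal
              (integrableOn_exp_mul_Ioi (by linarith) _)
              (ae_of_all _ fun _ => (Real.exp_pos _).le)]
            exact ENNReal.ofReal_lt_top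

theorem memLp_one (s : Side) {β : EReal} {c : ℝ} (h : Admissible β c) :
    MemLp (fun _ : ℝ => (1 : ℂ)) 2 (wMeasure s β c) :=
  have := isFiniteMeasure_wMeasure s h
  memLp_const 1

/-- The function that is identically `1`, as an element of the Hilbert space. -/
noncomputable def one (s : Side) (β : EReal) (c : ℝ) (h : Admissible β c) : HSpace s β c :=
  (memLp_one s h).toLp _

/-! ### The functions `k^∓`, their transforms, and functions of operators -/

/-- The space `ℒ^∓_ε`: real functions `k` on the line with `∫ |k x|² exp (ε |x|) dx < ∞` that
vanish on the open half line opposite to `ℝ^∓`. -/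
def MemL (s : Side) (ε : ℝ) (k : ℝ → ℝ) : Prop :=
  AEStronglyMeasurable k volume ∧
  Integrable (fun x : ℝ => |k x| ^ 2 * Real.exp (ε * |x|)) volume ∧
  ∀ x : ℝ, -x ∈ halfLine s → k x = 0

/-- The Fourier transform `k̂ x = ∫ exp (i x y) k y dy`. -/
noncomputable def khat (k : ℝ → ℝ) (x : ℝ) : ℂ :=
  ∫ y : ℝ, Complex.exp (Complex.I * x * y) * (k y : ℂ)

/-- The bounded operator `∓ i / (𝒥^∓ + δ I)`, defined by inverting `𝒥^∓ + δ I`. -/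
noncomputable def regOp (s : Side) (β : EReal) (c : ℝ) (h : Admissible β c) (δ : ℝ) :
    HSpace s β c →L[ℂ] HSpace s β c :=
  ((s.sgn : ℂ) * Complex.I) • Ring.inverse (J s β c h + (δ : ℂ) • 1)

/-- Cauchy's formula `f(A) = ∓ (2πi)⁻¹ ∫_ℝ f(y) (y I - A)⁻¹ dy` for the value at a bounded operator
`A`, whose spectrum lies in the open lower half plane (upper sign) or upper half plane (lower
sign), of the function that is analytic in that half plane and has boundary values `f` on `ℝ`. -/
noncomputable def cauchyValue {E : Type*} [NormedAddCommGroup E] [NormedSpace ℂ E]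
    (s : Side) (f : ℝ → ℂ) (A : E →L[ℂ] E) : E →L[ℂ] E :=
  ((s.sgn : ℂ) / (2 * Real.pi * Complex.I)) • ∫ y : ℝ, f y • resolvent A (y : ℂ)

/-- The operator `k̂(∓ i/𝒥^∓)` exists and equals `T`: for every `δ > 0` the operator
`A = ∓ i/(𝒥^∓ + δ I)` makes sense, its spectrum lies in the open half plane `{∓ Im z > 0}`
(`Im z < 0` for the upper sign, `Im z > 0` for the lower one), the Cauchy
integral for `k̂(A)` converges absolutely in operator norm, and
`k̂(∓ i/(𝒥^∓ + δ I))` tends to `T` strongly as `δ → 0+`. -/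
def IsOperatorValue (s : Side) (β : EReal) (c : ℝ) (h : Admissible β c) (f : ℝ → ℂ)
    (T : HSpace s β c →L[ℂ] HSpace s β c) : Prop :=
  (∀ δ : ℝ, 0 < δ →
    IsUnit (J s β c h + (δ : ℂ) • 1) ∧
    (∀ z ∈ spectrum ℂ (regOp s β c h δ), 0 < s.sgn * z.im) ∧
    Integrable (fun y : ℝ => f y • resolvent (regOp s β c h δ) (y : ℂ)) volume) ∧
  ∀ g : HSpace s β c,
    Tendsto (fun δ : ℝ => cauchyValue s f (regOp s β c h δ) g) (𝓝[>] 0) (𝓝 (T g))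

end FourierInv

/-!
Write `σ = ∓1`, `J = 𝒥^∓` and `B = (J + δ)⁻¹`. Integration by parts shows that `J` is accretive
(`accretive_J`), the weight `exp (-2 c |t|)` contributing a term of the right sign. Hence `J + δ` is
invertible, `B` is accretive with a positive lower bound, and `exp (-t B)` is a contraction
semigroup that decays exponentially. The resolvent of `i σ B` on the real line is, up to a factor,
the Fourier transform of this semigroup (`resolvent_eq`), so it is square integrable in operator
norm. By Plancherel's theorem `k̂` is square integrable too, which makes Cauchy's integral
absolutely convergent, and the integral equals `∫ k(x) exp (-|x| B) dx` (`cauchyValue_khat_apply`).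

In this form the limit `δ → 0` is elementary. The operators are bounded by `∫ |k|`, uniformly in
`δ`. On the range of `J ^ 2` the generators `(J + δ)⁻¹` differ by `O(|δ - η|)`, so by Duhamel's
formula the semigroups do as well, and an accretive injective operator has dense range
(`denseRange_of_accretive`). This gives the strong limit `T` (`exists_tendsto_regValue`).

The limit of the semigroups is the shift away from the origin, whose generator is `-1/J`. Only its
action on the function `1` is needed: the curve `u(t) = 1_{|x| > t}` satisfies `(J u)' = -u`
(`hasDerivWithinAt_J_shiftOne`), and Duhamel's formula identifies it as the limit of
`exp (-t (J + δ)⁻¹) 1` (`inner_J_J_limit_apply`). Therefore `T 1 = ∫ k(x) u(|x|) dx`, which is the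
convolution of `k` with `1`, that is `J k` (`integral_mul_inner_shiftOne`). Applying `1/J` recovers
`k`, and the representative of `J k` given by the integral is differentiable wherever `k` is
continuous.
-/

namespace FourierInv

/-! ### Exponentials of accretive operators -/

theorem Side.sgn_mul_sgn (s : Side) : (s.sgn : ℂ) * s.sgn = 1 := by
  cases s <;> simp [Side.sgn]

section Semigroup

variable {H : Type*} [NormedAddCommGroup H] [InnerProductSpace ℂ H]

/-- The numerical range of `C` lies in the half plane `{Re z ≥ m}`; for `m = 0` this is the usual
notion of an accretive operator. -/
def Accretive (C : H →L[ℂ] H) (m : ℝ) : Prop := ∀ x, m * ‖x‖ ^ 2 ≤ (inner ℂ (C x) x).re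

theorem Accretive.mono {C : H →L[ℂ] H} {m m' : ℝ} (hC : Accretive C m) (h : m' ≤ m) :
    Accretive C m' := fun x => le_trans (by gcongr) (hC x)

theorem Accretive.add_smul_one {C : H →L[ℂ] H} {m : ℝ} (hC : Accretive C m) (w : ℂ) :
    Accretive (C + w • 1) (m + w.re) := fun x => by
  have := hC x
  simp only [add_apply, smul_apply, one_apply_eq_self, inner_add_left, inner_smul_left,
    inner_self_eq_norm_sq_to_K, Complex.add_re]
  have h2 : ((starRingEnd ℂ) w * ((‖x‖ : ℝ) : ℂ) ^ 2).re = w.re * ‖x‖ ^ 2 := by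
    rw [← Complex.ofReal_pow, Complex.re_mul_ofReal]; simp
  erw [h2]; linarith

variable [CompleteSpace H]

/-- The one-parameter group `exp (-t C)` generated by a bounded operator `-C`. -/
noncomputable def expNeg (C : H →L[ℂ] H) (t : ℝ) : H →L[ℂ] H := NormedSpace.exp (t • (-C))

theorem hasDerivAt_expNeg (C : H →L[ℂ] H) (t : ℝ) :
    HasDerivAt (expNeg C) (-(expNeg C t * C)) t := by
  have h := hasDerivAt_exp_smul_const (𝕂 := ℝ) (-C) t
  rwa [mul_neg] at h

theorem hasDerivAt_expNeg' (C : H →L[ℂ] H) (t : ℝ) :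
    HasDerivAt (expNeg C) (-(C * expNeg C t)) t := by
  have h := hasDerivAt_exp_smul_const' (𝕂 := ℝ) (-C) t
  rwa [neg_mul] at h

theorem hasDerivAt_expNeg_apply (C : H →L[ℂ] H) (x : H) (t : ℝ) :
    HasDerivAt (fun r => expNeg C r x) (-(C (expNeg C t x))) t := by
  have h := (((ContinuousLinearMap.apply ℂ H x).restrictScalars ℝ).hasFDerivAt).comp_hasDerivAt t
    (hasDerivAt_expNeg' C t)
  simpa [Function.comp_def] using h

theorem continuous_expNeg (C : H →L[ℂ] H) : Continuous (expNeg C) :=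
  continuous_iff_continuousAt.2 fun t => (hasDerivAt_expNeg C t).continuousAt

@[simp] theorem expNeg_zero (C : H →L[ℂ] H) : expNeg C 0 = 1 := by simp [expNeg]

theorem commute_expNeg {C D : H →L[ℂ] H} (h : Commute D C) (t : ℝ) : Commute D (expNeg C t) :=
  (h.neg_right.smul_right _).exp_right

theorem expNeg_add_smul_one (C : H →L[ℂ] H) (w : ℂ) (t : ℝ) :
    expNeg (C + w • 1) t = Complex.exp (-(t * w)) • expNeg C t := by
  let _ : NormedAlgebra ℚ (H →L[ℂ] H) := NormedAlgebra.restrictScalars ℚ ℂ _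
  have hw : t • (-(w • (1 : H →L[ℂ] H))) = algebraMap ℂ _ (-(t * w)) := by
    rw [Algebra.algebraMap_eq_smul_one, ← neg_smul, ← smul_assoc]
    simp
  have hc : Commute (t • (-C)) (t • (-(w • (1 : H →L[ℂ] H)))) := by
    rw [hw]; exact (Algebra.commutes _ _).symm
  rw [expNeg, neg_add, smul_add, NormedSpace.exp_add_of_commute hc, hw,
    ← NormedSpace.algebraMap_exp_comm, Algebra.algebraMap_eq_smul_one, mul_smul_comm, mul_one,
    Complex.exp_eq_exp_ℂ, expNeg]

open scoped InnerProductSpace in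
theorem norm_expNeg_le {C : H →L[ℂ] H} {m : ℝ} (hC : Accretive C m) {t : ℝ} (ht : 0 ≤ t) :
    ‖expNeg C t‖ ≤ Real.exp (-(m * t)) := by
  refine ContinuousLinearMap.opNorm_le_bound _ (Real.exp_pos _).le fun x => ?_
  -- `exp (2 m t) ‖exp (-t C) x‖ ^ 2` is nonincreasing
  have hd : ∀ r : ℝ, HasDerivAt (fun r => expNeg C r x) (-(C (expNeg C r x))) r := fun r =>
    hasDerivAt_expNeg_apply C x r
  let _ : InnerProductSpace ℝ H := InnerProductSpace.rclikeToReal ℂ H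
  have hd2 : ∀ r : ℝ, HasDerivAt (fun r => Real.exp (2 * m * r) * ‖expNeg C r x‖ ^ 2)
      (Real.exp (2 * m * r) * (2 * m) * ‖expNeg C r x‖ ^ 2 + Real.exp (2 * m * r) *
        (2 * ⟪expNeg C r x, -(C (expNeg C r x))⟫_ℝ)) r := fun r => by
    have h1 : HasDerivAt (fun r : ℝ => Real.exp (2 * m * r))
        (Real.exp (2 * m * r) * (2 * m)) r := by
      simpa using ((hasDerivAt_id r).const_mul (2 * m)).exp
    exact h1.mul (hd r).norm_sq
  have hanti : Antitone (fun r => Real.exp (2 * m * r) * ‖expNeg C r x‖ ^ 2) := by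
    refine antitone_of_deriv_nonpos (fun r => (hd2 r).differentiableAt) fun r => ?_
    rw [(hd2 r).deriv]
    have h3 := hC (expNeg C r x)
    have h4 : ⟪expNeg C r x, -(C (expNeg C r x))⟫_ℝ =
        -(inner ℂ (C (expNeg C r x)) (expNeg C r x)).re := by
      rw [inner_neg_right, real_inner_comm]; rfl
    rw [h4]
    have := Real.exp_pos (2 * m * r)
    nlinarith
  have h := hanti ht
  simp only [mul_zero, Real.exp_zero, expNeg_zero, one_mul, one_apply_eq_self] at h
  have h5 : ‖expNeg C t x‖ ^ 2 ≤ (Real.exp (-(m * t)) * ‖x‖) ^ 2 := by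
    rw [mul_pow, ← Real.exp_nat_mul]
    calc _ = Real.exp (-(2 * m * t)) * (Real.exp (2 * m * t) * ‖expNeg C t x‖ ^ 2) := by
          rw [← mul_assoc, ← Real.exp_add]; simp
      _ ≤ Real.exp (-(2 * m * t)) * ‖x‖ ^ 2 := by gcongr
      _ = _ := by congr 2; push_cast; ring
  exact le_of_sq_le_sq h5 (by positivity)

theorem norm_expNeg_apply_le {C : H →L[ℂ] H} (hC : Accretive C 0) {t : ℝ} (ht : 0 ≤ t) (x : H) :
    ‖expNeg C t x‖ ≤ ‖x‖ := by
  refine (ContinuousLinearMap.le_of_opNorm_le _ (norm_expNeg_le hC ht) x).trans ?_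
  simp

theorem integrableOn_expNeg {C : H →L[ℂ] H} {m : ℝ} (hm : 0 < m) (hC : Accretive C m) :
    IntegrableOn (expNeg C) (Set.Ioi 0) := by
  refine Integrable.mono' (integrableOn_exp_mul_Ioi (a := -m) (by linarith) 0)
    (continuous_expNeg C).aestronglyMeasurable ?_
  filter_upwards [ae_restrict_mem measurableSet_Ioi] with t ht
  simpa using norm_expNeg_le hC (le_of_lt ht)

theorem tendsto_expNeg {C : H →L[ℂ] H} {m : ℝ} (hm : 0 < m) (hC : Accretive C m) :
    Tendsto (expNeg C) atTop (𝓝 0) := by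
  refine squeeze_zero_norm' (a := fun t => Real.exp (-(m * t))) ?_ ?_
  · filter_upwards [eventually_ge_atTop 0] with t ht using norm_expNeg_le hC ht
  · exact Real.tendsto_exp_neg_atTop_nhds_zero.comp (tendsto_id.const_mul_atTop hm)

theorem expNeg_integral_mul {C : H →L[ℂ] H} {m : ℝ} (hm : 0 < m) (hC : Accretive C m) :
    (∫ t in Set.Ioi (0 : ℝ), expNeg C t) * C = 1 := by
  have h := integral_Ioi_of_hasDerivAt_of_tendsto (a := 0) (f := expNeg C)
    (f' := fun t => -(expNeg C t * C)) (continuous_expNeg C).continuousWithinAt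
    (fun t _ => hasDerivAt_expNeg C t) (((integrableOn_expNeg hm hC).mul_const C).neg)
    (tendsto_expNeg hm hC)
  rw [integral_neg, integral_mul_const_of_integrable (integrableOn_expNeg hm hC)] at h
  simpa using h

theorem mul_expNeg_integral {C : H →L[ℂ] H} {m : ℝ} (hm : 0 < m) (hC : Accretive C m) :
    C * (∫ t in Set.Ioi (0 : ℝ), expNeg C t) = 1 := by
  have h := integral_Ioi_of_hasDerivAt_of_tendsto (a := 0) (f := expNeg C)
    (f' := fun t => -(C * expNeg C t)) (continuous_expNeg C).continuousWithinAt
    (fun t _ => hasDerivAt_expNeg' C t) (((integrableOn_expNeg hm hC).const_mul C).neg)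
    (tendsto_expNeg hm hC)
  rw [integral_neg, integral_const_mul_of_integrable (integrableOn_expNeg hm hC)] at h
  simpa using h

/-- The inverse is `∫₀^∞ exp (-t C) dt`, which converges in norm because `exp (-t C)` decays. -/
theorem isUnit_of_accretive {C : H →L[ℂ] H} {m : ℝ} (hm : 0 < m) (hC : Accretive C m) : IsUnit C :=
  ⟨⟨C, _, mul_expNeg_integral hm hC, expNeg_integral_mul hm hC⟩, rfl⟩

theorem inverse_eq_integral {C : H →L[ℂ] H} {m : ℝ} (hm : 0 < m) (hC : Accretive C m) :
    Ring.inverse C = ∫ t in Set.Ioi (0 : ℝ), expNeg C t :=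
  Ring.inverse_unit ⟨C, _, mul_expNeg_integral hm hC, expNeg_integral_mul hm hC⟩

theorem norm_inverse_le {C : H →L[ℂ] H} {m : ℝ} (hm : 0 < m) (hC : Accretive C m) :
    ‖Ring.inverse C‖ ≤ 1 / m := by
  rw [inverse_eq_integral hm hC]
  refine (norm_integral_le_of_norm_le
    (integrableOn_exp_mul_Ioi (a := -m) (by linarith) 0) ?_).trans ?_
  · filter_upwards [ae_restrict_mem measurableSet_Ioi] with t ht
    simpa using norm_expNeg_le hC (le_of_lt ht)
  · rw [integral_exp_mul_Ioi (by linarith)]; simp [neg_div_neg_eq]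

/-- The constant is `m / ‖C‖ ^ 2`, up to avoiding a division by zero: for `x = C y` one has
`Re ⟪C⁻¹ x, x⟫ = Re ⟪y, C y⟫ ≥ m ‖y‖ ^ 2`. -/
theorem accretive_inverse {C : H →L[ℂ] H} {m : ℝ} (hm : 0 < m) (hC : Accretive C m) :
    ∃ m' > 0, Accretive (Ring.inverse C) m' := by
  have hu := isUnit_of_accretive hm hC
  refine ⟨m / (‖C‖ + 1) ^ 2, by positivity, fun x => ?_⟩
  set y := Ring.inverse C x
  have hx : x = C y := by
    change x = (C * Ring.inverse C) x
    rw [Ring.mul_inverse_cancel _ hu]; rfl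
  have h1 := hC y
  rw [← hx, ← inner_conj_symm, Complex.conj_re] at h1
  refine le_trans ?_ h1
  have h2 : ‖x‖ ≤ (‖C‖ + 1) * ‖y‖ := by
    rw [hx]; refine (C.le_opNorm y).trans ?_; gcongr; linarith
  rw [div_mul_eq_mul_div, div_le_iff₀ (by positivity), mul_assoc, ← mul_pow, mul_comm ‖y‖]
  gcongr

/-- Since `z - i σ B = -i σ (B + i σ z)` for `σ = ±1`, the resolvent of `i σ B` at `z` is `i σ`
times the Laplace integral that inverts `B + i σ z`. -/
theorem resolvent_eq {B : H →L[ℂ] H} {m : ℝ} (hB : Accretive B m) (s : Side)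
    {z : ℂ} (hz : s.sgn * z.im < m) :
    z ∈ resolventSet ℂ (((s.sgn : ℂ) * Complex.I) • B) ∧
    resolvent (((s.sgn : ℂ) * Complex.I) • B) z = ((s.sgn : ℂ) * Complex.I) •
      ∫ t in Set.Ioi (0 : ℝ), Complex.exp (-(t * (s.sgn * Complex.I * z))) • expNeg B t := by
  have hC := hB.add_smul_one (s.sgn * Complex.I * z)
  have hre : m + (s.sgn * Complex.I * z).re = m - s.sgn * z.im := by simp; ring
  rw [hre] at hC
  have hm : 0 < m - s.sgn * z.im := by linarith
  have hss := s.sgn_mul_sgn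
  have hu : (s.sgn : ℂ) * Complex.I * (-(s.sgn * Complex.I)) = 1 := by
    linear_combination (-Complex.I ^ 2) * hss - Complex.I_sq
  let w : ℂˣ := ⟨-(s.sgn * Complex.I), s.sgn * Complex.I, by rw [mul_comm, hu], hu⟩
  have key : algebraMap ℂ (H →L[ℂ] H) z - ((s.sgn : ℂ) * Complex.I) • B =
      w • (B + (s.sgn * Complex.I * z) • 1) := by
    have h1 : -((s.sgn : ℂ) * Complex.I) * (s.sgn * Complex.I * z) = z := by
      linear_combination z * hu
    rw [Units.smul_def, smul_add, smul_smul, Algebra.algebraMap_eq_smul_one]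
    simp only [w]
    rw [h1, neg_smul, sub_eq_add_neg, add_comm]
  have hU := isUnit_of_accretive hm hC
  constructor
  · rw [spectrum.mem_resolventSet_iff, key]
    exact hU.smul w
  · rw [resolvent, key]
    rw [← setIntegral_congr_fun measurableSet_Ioi fun t _ => expNeg_add_smul_one B _ t,
      ← inverse_eq_integral hm hC]
    obtain ⟨U, hU⟩ := hU
    rw [← hU, ← Units.val_smul, Ring.inverse_unit, Ring.inverse_unit]
    rfl

theorem spectrum_im_pos {B : H →L[ℂ] H} {m : ℝ} (hm : 0 < m) (hB : Accretive B m) (s : Side)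
    {z : ℂ} (hz : z ∈ spectrum ℂ (((s.sgn : ℂ) * Complex.I) • B)) : 0 < s.sgn * z.im := by
  by_contra! h
  exact hz (resolvent_eq hB s (h.trans_lt hm)).1

theorem continuous_resolvent {B : H →L[ℂ] H} {m : ℝ} (hm : 0 < m) (hB : Accretive B m)
    (s : Side) : Continuous fun y : ℝ => resolvent (((s.sgn : ℂ) * Complex.I) • B) (y : ℂ) := by
  refine continuous_iff_continuousAt.2 fun y => ?_
  have h := (spectrum.hasDerivAt_resolvent_const_left
    (resolvent_eq hB s (z := (y : ℂ)) (by simpa using hm)).1).continuousAt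
  exact ContinuousAt.comp (f := fun y : ℝ => (y : ℂ)) h Complex.continuous_ofReal.continuousAt

/-- On the real line the resolvent is bounded, and the resolvent identity
`y R(y) = 1 + R(y) A` turns boundedness into decay of order `1 / |y|`. -/
theorem exists_norm_resolvent_le {B : H →L[ℂ] H} {m : ℝ} (hm : 0 < m) (hB : Accretive B m)
    (s : Side) :
    ∃ M, ∀ y : ℝ, ‖resolvent (((s.sgn : ℂ) * Complex.I) • B) (y : ℂ)‖ * (1 + |y|) ≤ M := by
  set A := ((s.sgn : ℂ) * Complex.I) • B
  refine ⟨1 / m + (1 + 1 / m * ‖A‖), fun y => ?_⟩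
  obtain ⟨hy, heq⟩ := resolvent_eq hB s (z := (y : ℂ)) (by simpa using hm)
  have h1 : ‖resolvent A (y : ℂ)‖ ≤ 1 / m := by
    rw [heq, norm_smul]
    have : ‖(s.sgn : ℂ) * Complex.I‖ = 1 := by cases s <;> simp [Side.sgn]
    rw [this, one_mul]
    refine (norm_integral_le_of_norm_le
      (integrableOn_exp_mul_Ioi (a := -m) (by linarith) 0) ?_).trans ?_
    · filter_upwards [ae_restrict_mem measurableSet_Ioi] with t ht
      rw [norm_smul, Complex.norm_exp]
      simpa using norm_expNeg_le hB (le_of_lt ht)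
    · rw [integral_exp_mul_Ioi (by linarith)]; simp [neg_div_neg_eq]
  have h2 : (y : ℂ) • resolvent A (y : ℂ) = 1 + resolvent A (y : ℂ) * A := by
    have := Ring.inverse_mul_cancel _ (spectrum.mem_resolventSet_iff.1 hy)
    rw [mul_sub, Algebra.algebraMap_eq_smul_one, mul_smul_comm, mul_one, sub_eq_iff_eq_add] at this
    exact this
  have h3 : |y| * ‖resolvent A (y : ℂ)‖ ≤ 1 + 1 / m * ‖A‖ := by
    have h4 := congrArg norm h2
    rw [norm_smul, Complex.norm_real, Real.norm_eq_abs] at h4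
    rw [h4]
    refine (norm_add_le _ _).trans (add_le_add ?_ ((norm_mul_le _ _).trans (by gcongr)))
    exact ContinuousLinearMap.norm_id_le
  linarith

theorem memLp_resolvent {B : H →L[ℂ] H} {m : ℝ} (hm : 0 < m) (hB : Accretive B m)
    (s : Side) :
    MemLp (fun y : ℝ => resolvent (((s.sgn : ℂ) * Complex.I) • B) (y : ℂ)) 2 volume := by
  have hc := continuous_resolvent hm hB s
  obtain ⟨M, hM⟩ := exists_norm_resolvent_le hm hB s
  rw [memLp_two_iff_integrable_sq_norm hc.aestronglyMeasurable]
  refine (integrable_inv_one_add_sq.const_mul (M ^ 2)).mono'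
    (hc.norm.pow 2).aestronglyMeasurable (ae_of_all _ fun y => ?_)
  rw [Real.norm_of_nonneg (by positivity), ← div_eq_mul_inv, le_div_iff₀ (by positivity)]
  have h1 := hM y
  have h0 := norm_nonneg (resolvent (((s.sgn : ℂ) * Complex.I) • B) (y : ℂ))
  calc _ ≤ ‖resolvent (((s.sgn : ℂ) * Complex.I) • B) (y : ℂ)‖ ^ 2 * (1 + |y|) ^ 2 := by
        gcongr; nlinarith [abs_nonneg y, sq_abs y]
    _ ≤ _ := by rw [← mul_pow]; gcongr

end Semigroup

/-! ### Plancherel's theorem for integrable, square integrable functions -/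

section Plancherel

open FourierTransform SchwartzMap

/-- On `L¹ ∩ L²` the Fourier transform of `L²`, defined by continuity, is given by the Fourier
integral: both define the same tempered distribution. -/
theorem fourier_toLp_coeFn {f : ℝ → ℂ} (h1 : Integrable f) (h2 : MemLp f 2) :
    (𝓕 (h2.toLp f) : Lp ℂ 2 (volume : Measure ℝ)) =ᵐ[volume] 𝓕 f := by
  have hcont : Continuous (𝓕 f) :=
    VectorFourier.fourierIntegral_continuous Real.continuous_fourierChar continuous_inner h1
  refine ae_eq_of_integral_contDiff_smul_eq
    ((Lp.memLp _).locallyIntegrable (by norm_num)) hcont.locallyIntegrable fun φ hφ hφc => ?_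
  have hφ' : ContDiff ℝ (⊤ : ℕ∞) (fun x => (φ x : ℂ)) := Complex.ofRealCLM.contDiff.comp hφ
  have hφc' : HasCompactSupport (fun x => (φ x : ℂ)) := hφc.comp_left Complex.ofReal_zero
  let ψ : 𝓢(ℝ, ℂ) := hφc'.toSchwartzMap hφ'
  have key := DFunLike.congr_fun (Lp.fourier_toTemperedDistribution_eq (h2.toLp f)) ψ
  rw [TemperedDistribution.fourier_apply, Lp.toTemperedDistribution_apply,
    Lp.toTemperedDistribution_apply] at key
  have hψ : ∀ x, ψ x = (φ x : ℂ) := fun x => rfl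
  calc ∫ x, φ x • (𝓕 (h2.toLp f) : Lp ℂ 2 (volume : Measure ℝ)) x
      = ∫ x, ψ x • (𝓕 (h2.toLp f) : Lp ℂ 2 (volume : Measure ℝ)) x := by
        simp [hψ]
    _ = ∫ x, (𝓕 ψ) x • (h2.toLp f) x := key.symm
    _ = ∫ x, (𝓕 (ψ : ℝ → ℂ)) x • f x := by
        refine integral_congr_ae ?_
        filter_upwards [h2.coeFn_toLp] with x hx
        rw [hx, SchwartzMap.fourier_coe]
    _ = ∫ x, ψ x • 𝓕 f x := by
        have h := VectorFourier.integral_fourierIntegral_smul_eq_flip (L := innerₗ ℝ)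
          (μ := volume) (ν := volume) Real.continuous_fourierChar continuous_inner ψ.integrable h1
        rw [flip_innerₗ] at h
        exact h
    _ = _ := by simp [hψ]

theorem memLp_fourier {f : ℝ → ℂ} (h1 : Integrable f) (h2 : MemLp f 2) :
    MemLp (𝓕 f) 2 (volume : Measure ℝ) :=
  (memLp_congr_ae (fourier_toLp_coeFn h1 h2)).1 (Lp.memLp _)

theorem integral_inner_fourier {f g : ℝ → ℂ} (hf : Integrable f) (hf2 : MemLp f 2)
    (hg : Integrable g) (hg2 : MemLp g 2) :
    ∫ ξ, inner ℂ (𝓕 f ξ) (𝓕 g ξ) = ∫ x, inner ℂ (f x) (g x) := by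
  have h := Lp.inner_fourier_eq (hf2.toLp f) (hg2.toLp g)
  rw [L2.inner_def, L2.inner_def] at h
  calc _ = _ := integral_congr_ae ?_
    _ = _ := h
    _ = _ := integral_congr_ae ?_
  · filter_upwards [fourier_toLp_coeFn hf hf2, fourier_toLp_coeFn hg hg2] with x h1 h2
    rw [h1, h2]
  · filter_upwards [hf2.coeFn_toLp, hg2.coeFn_toLp] with x h1 h2
    rw [h1, h2]

/-- The transform `k̂` uses the kernel `exp (i x y)`, Mathlib's `𝓕` the kernel `exp (-2 π i x y)`;
for real `k` they differ by a dilation and a conjugation. -/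
theorem khat_eq (k : ℝ → ℝ) (y : ℝ) :
    khat k y = starRingEnd ℂ (𝓕 (fun x => (k x : ℂ)) (y / (2 * Real.pi))) := by
  rw [Real.fourier_eq', ← integral_conj, khat]
  congr 1 with x
  rw [smul_eq_mul, map_mul, ← Complex.exp_conj, map_mul, Complex.conj_I, Complex.conj_ofReal,
    Complex.conj_ofReal]
  congr 2
  have : (Real.pi : ℂ) ≠ 0 := by exact_mod_cast Real.pi_ne_zero
  simp
  field_simp

theorem memLp_khat {k : ℝ → ℝ} (h1 : Integrable k) (h2 : MemLp k 2) : MemLp (khat k) 2 := by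
  have h := (memLp_fourier h1.ofReal (h2.ofReal (K := ℂ))).star
  have hπ : (1 / (2 * Real.pi)) ≠ 0 := by have := Real.pi_pos; positivity
  have : khat k = (star (𝓕 (fun x => (k x : ℂ)))) ∘ (fun y => (1 / (2 * Real.pi)) * y) := by
    ext y; rw [khat_eq, Function.comp, one_div_mul_eq_div]; rfl
  rw [this]
  refine MemLp.comp_of_map ?_ (by fun_prop)
  rw [Real.map_volume_mul_left hπ]
  exact h.smul_measure ENNReal.ofReal_ne_top

theorem integral_khat_mul_fourier {k : ℝ → ℝ} {φ : ℝ → ℂ} (hk : Integrable k) (hk2 : MemLp k 2)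
    (hφ : Integrable φ) (hφ2 : MemLp φ 2) :
    ∫ y, khat k y * 𝓕 φ (y / (2 * Real.pi)) = 2 * Real.pi * ∫ x, (k x : ℂ) * φ x := by
  have h := integral_inner_fourier hk.ofReal (hk2.ofReal (K := ℂ)) hφ hφ2
  simp only [RCLike.inner_apply, RCLike.ofReal_eq_complex_ofReal, Complex.conj_ofReal] at h
  simp only [khat_eq]
  rw [Measure.integral_comp_div
    (fun ξ => starRingEnd ℂ (𝓕 (fun x => (k x : ℂ)) ξ) * 𝓕 φ ξ) (2 * Real.pi),
    abs_of_pos (by have := Real.pi_pos; positivity)]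
  simp only [mul_comm _ (𝓕 φ _), h, Complex.real_smul]
  push_cast
  simp only [mul_comm (φ _)]

end Plancherel

/-! ### Cauchy's formula as a Laplace integral -/

theorem integrable_exp_neg_mul_abs {a : ℝ} (ha : 0 < a) :
    Integrable fun x : ℝ => Real.exp (-(a * |x|)) := by
  rw [← integrableOn_univ, ← Set.Iic_union_Ioi (a := (0 : ℝ))]
  refine IntegrableOn.union ?_ ?_
  · refine (integrableOn_exp_mul_Iic ha 0).congr_fun (fun x hx => ?_) measurableSet_Iic
    simp [abs_of_nonpos (Set.mem_Iic.1 hx)]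
  · refine (integrableOn_exp_mul_Ioi (a := -a) (by linarith) 0).congr_fun (fun x hx => ?_)
      measurableSet_Ioi
    simp [abs_of_pos (Set.mem_Ioi.1 hx)]

theorem integral_Ioi_eq_integral_halfLine {E : Type*} [NormedAddCommGroup E] [NormedSpace ℝ E]
    (s : Side) (f : ℝ → E) : ∫ t in Set.Ioi (0 : ℝ), f t = ∫ x in halfLine s, f (s.sgn * x) := by
  cases s
  · simpa [halfLine, Side.sgn, integral_Iic_eq_integral_Iio] using (integral_comp_neg_Iic 0 f).symm
  · simp [halfLine, Side.sgn]

theorem measurableSet_halfLine (s : Side) : MeasurableSet (halfLine s) := by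
  cases s
  exacts [measurableSet_Iio, measurableSet_Ioi]

theorem sgn_mul_eq_abs {s : Side} {x : ℝ} (hx : x ∈ halfLine s) : s.sgn * x = |x| := by
  cases s
  · simp only [halfLine, Set.mem_Iio] at hx; simp [Side.sgn, abs_of_neg hx]
  · simp only [halfLine, Set.mem_Ioi] at hx; simp [Side.sgn, abs_of_pos hx]

section Cauchy

variable {H : Type*} [NormedAddCommGroup H] [InnerProductSpace ℂ H] [CompleteSpace H]

theorem integrable_smul_expNeg {B : H →L[ℂ] H} (hB : Accretive B 0) {k : ℝ → ℝ}
    (hk : Integrable k) (g : H) : Integrable fun x : ℝ => k x • expNeg B |x| g := by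
  have hc : Continuous fun x : ℝ => expNeg B |x| g :=
    ((continuous_expNeg B).comp continuous_abs).clm_apply continuous_const
  refine (hk.norm.mul_const ‖g‖).mono' (hk.aestronglyMeasurable.smul hc.aestronglyMeasurable)
    (ae_of_all _ fun x => ?_)
  rw [norm_smul]
  gcongr
  exact norm_expNeg_apply_le hB (abs_nonneg x) g

theorem integrable_khat_smul_resolvent {B : H →L[ℂ] H} {m : ℝ} (hm : 0 < m) (hB : Accretive B m)
    (s : Side) {k : ℝ → ℝ} (hk : Integrable k) (hk2 : MemLp k 2) :
    Integrable fun y : ℝ => khat k y • resolvent (((s.sgn : ℂ) * Complex.I) • B) (y : ℂ) :=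
  memLp_one_iff_integrable.1 ((memLp_resolvent hm hB s).smul (memLp_khat hk hk2))

open FourierTransform in
/-- The matrix elements of the resolvent on the real line are Fourier transforms of those of the
semigroup `exp (-t B)`, transplanted to the half line `ℝ^∓`. -/
theorem inner_resolvent_eq_fourier {B : H →L[ℂ] H} {m : ℝ} (hm : 0 < m) (hB : Accretive B m)
    (s : Side) (g h : H) (y : ℝ) :
    inner ℂ h (resolvent (((s.sgn : ℂ) * Complex.I) • B) (y : ℂ) g) = ((s.sgn : ℂ) * Complex.I) *
      𝓕 ((halfLine s).indicator fun x => inner ℂ h (expNeg B |x| g)) (y / (2 * Real.pi)) := by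
  obtain ⟨-, heq⟩ := resolvent_eq hB s (z := (y : ℂ)) (by simpa using hm)
  have hint : IntegrableOn (fun t : ℝ => Complex.exp (-(t * (s.sgn * Complex.I * y))) •
      expNeg B t) (Set.Ioi 0) := by
    refine (integrableOn_expNeg hm hB).norm.mono' ?_ (ae_of_all _ fun t => ?_)
    · exact ((by fun_prop : Continuous fun t : ℝ =>
        Complex.exp (-(t * (s.sgn * Complex.I * y)))).smul
        (continuous_expNeg B)).aestronglyMeasurable
    · rw [norm_smul, Complex.norm_exp]; simp
  rw [heq, smul_apply, inner_smul_right, ContinuousLinearMap.integral_apply hint]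
  congr 1
  rw [← integral_inner (hint.apply_continuousLinearMap g),
    integral_Ioi_eq_integral_halfLine s, Real.fourier_eq',
    ← integral_indicator (measurableSet_halfLine s)]
  congr 1 with x
  by_cases hx : x ∈ halfLine s
  · have hss := s.sgn_mul_sgn
    have hπ : (Real.pi : ℂ) ≠ 0 := by exact_mod_cast Real.pi_ne_zero
    rw [Set.indicator_of_mem hx, Set.indicator_of_mem hx, sgn_mul_eq_abs hx, smul_apply,
      inner_smul_right, smul_eq_mul, ← sgn_mul_eq_abs hx]
    congr 2
    simp only [Complex.ofReal_mul, RCLike.inner_apply, conj_trivial, Complex.ofReal_div,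
      Complex.ofReal_neg, Complex.ofReal_ofNat]
    field_simp
    linear_combination (-x * y) * hss
  · simp [hx]

theorem norm_inner_expNeg_le {B : H →L[ℂ] H} {m : ℝ} (hB : Accretive B m) (s : Side) (g h : H)
    (x : ℝ) : ‖(halfLine s).indicator (fun x => inner ℂ h (expNeg B |x| g)) x‖ ≤
      ‖h‖ * ‖g‖ * Real.exp (-(m * |x|)) := by
  refine (norm_indicator_le_norm_self _ _).trans ?_
  refine (norm_inner_le_norm _ _).trans ?_
  rw [mul_assoc]
  gcongr
  rw [mul_comm]
  exact ContinuousLinearMap.le_of_opNorm_le _ (norm_expNeg_le hB (abs_nonneg x)) g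

/-- Cauchy's formula for `k̂ (i σ B)` equals `∫ k(x) exp (-|x| B) dx`. As `k̂` need not be
integrable, Fubini's theorem does not apply, and the matrix elements are compared by Plancherel's
theorem instead. -/
theorem cauchyValue_khat_apply {B : H →L[ℂ] H} {m : ℝ} (hm : 0 < m) (hB : Accretive B m)
    (s : Side) {k : ℝ → ℝ} (hk : Integrable k) (hk2 : MemLp k 2)
    (hk0 : ∀ x, -x ∈ halfLine s → k x = 0) (g : H) :
    cauchyValue s (khat k) (((s.sgn : ℂ) * Complex.I) • B) g = ∫ x, k x • expNeg B |x| g := by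
  refine ext_inner_left ℂ fun h => ?_
  have hB0 : Accretive B 0 := hB.mono hm.le
  have hint := integrable_khat_smul_resolvent hm hB s hk hk2
  set φ : ℝ → ℂ := (halfLine s).indicator fun x => inner ℂ h (expNeg B |x| g)
  have hφm : AEStronglyMeasurable φ := by
    refine (Continuous.aestronglyMeasurable ?_).indicator (measurableSet_halfLine s)
    exact continuous_const.inner
      (((continuous_expNeg B).comp continuous_abs).clm_apply continuous_const)
  have hφ1 : Integrable φ :=
    ((integrable_exp_neg_mul_abs hm).const_mul (‖h‖ * ‖g‖)).mono' hφm
      (ae_of_all _ (norm_inner_expNeg_le hB s g h))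
  have hφ2 : MemLp φ 2 := by
    rw [memLp_two_iff_integrable_sq_norm hφm]
    refine ((integrable_exp_neg_mul_abs (a := 2 * m) (by linarith)).const_mul
      ((‖h‖ * ‖g‖) ^ 2)).mono' (hφm.norm.pow 2) (ae_of_all _ fun x => ?_)
    rw [Real.norm_of_nonneg (by positivity)]
    have h2 : Real.exp (-(2 * m * |x|)) = Real.exp (-(m * |x|)) ^ 2 := by
      rw [← Real.exp_nat_mul]; congr 1; push_cast; ring
    rw [h2, ← mul_pow]
    gcongr
    exact norm_inner_expNeg_le hB s g h x
  rw [cauchyValue, smul_apply, inner_smul_right, ContinuousLinearMap.integral_apply hint,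
    ← integral_inner (hint.apply_continuousLinearMap g),
    ← integral_inner (integrable_smul_expNeg hB0 hk g)]
  simp only [smul_apply, inner_smul_right, inner_resolvent_eq_fourier hm hB s g h]
  have h3 := integral_khat_mul_fourier hk hk2 hφ1 hφ2
  simp only [mul_left_comm (khat k _), integral_const_mul]
  rw [h3]
  have hss := s.sgn_mul_sgn
  have hπ : (Real.pi : ℂ) ≠ 0 := by exact_mod_cast Real.pi_ne_zero
  have h4 : ∫ x, (k x : ℂ) * φ x = ∫ x, inner ℂ h (k x • expNeg B |x| g) := by
    refine integral_congr_ae ?_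
    filter_upwards [Measure.ae_ne volume (0 : ℝ)] with x hx
    by_cases hxs : x ∈ halfLine s
    · simp only [φ, Set.indicator_of_mem hxs]
      rw [← Complex.coe_smul, inner_smul_right]
    · have : k x = 0 := hk0 x (by
        cases s
        · simp only [halfLine, Set.mem_Iio] at *; rcases lt_or_gt_of_ne hx with h | h <;> linarith
        · simp only [halfLine, Set.mem_Ioi] at *; rcases lt_or_gt_of_ne hx with h | h <;> linarith)
      simp [this]
  rw [h4]
  field_simp
  linear_combination (∫ x, inner ℂ h (k x • expNeg B |x| g)) * hss

theorem norm_cauchyValue_khat_le {B : H →L[ℂ] H} {m : ℝ} (hm : 0 < m) (hB : Accretive B m)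
    (s : Side) {k : ℝ → ℝ} (hk : Integrable k) (hk2 : MemLp k 2)
    (hk0 : ∀ x, -x ∈ halfLine s → k x = 0) (g : H) :
    ‖cauchyValue s (khat k) (((s.sgn : ℂ) * Complex.I) • B) g‖ ≤ (∫ x, |k x|) * ‖g‖ := by
  rw [cauchyValue_khat_apply hm hB s hk hk2 hk0, ← integral_mul_const]
  have hB0 : Accretive B 0 := hB.mono hm.le
  refine norm_integral_le_of_norm_le (hk.norm.mul_const ‖g‖) (ae_of_all _ fun x => ?_)
  rw [norm_smul]
  gcongr
  exacts [le_rfl, norm_expNeg_apply_le hB0 (abs_nonneg x) g]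

end Cauchy

/-! ### The strong limit -/

section StrongLimit

variable {H : Type*} [NormedAddCommGroup H] [InnerProductSpace ℂ H]

/-- An injective accretive operator has dense range. -/
theorem denseRange_of_accretive [CompleteSpace H] {J : H →L[ℂ] H} (hJ : Accretive J 0)
    (hinj : Function.Injective J) : DenseRange J := by
  have h : (LinearMap.range J.toLinearMap)ᗮ = ⊥ := by
    rw [Submodule.eq_bot_iff]
    intro x hx
    have hx' : ∀ y, inner ℂ (J y) x = 0 := fun y =>
      (Submodule.mem_orthogonal _ _).1 hx (J y) ⟨y, rfl⟩
    have hpos : ∀ y, 0 ≤ (inner ℂ (J y) y).re := fun y => by simpa using hJ y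
    have hz : J x = 0 := by
      by_contra hne
      have hN : 0 < ‖J x‖ ^ 2 := by positivity
      have hQ := hpos (J x)
      set N := ‖J x‖ ^ 2
      set Q := (inner ℂ (J (J x)) (J x)).re
      -- accretivity at `x - a J x` gives `N ≤ a Q` for every `a > 0`; this `a` contradicts it
      set a := N / (2 * (Q + 1)) with ha
      have ha0 : 0 < a := by positivity
      have h1 := hpos (x + ((-a : ℝ) : ℂ) • J x)
      have h2 : (inner ℂ (J (x + ((-a : ℝ) : ℂ) • J x)) (x + ((-a : ℝ) : ℂ) • J x)).re =
          -a * N + a ^ 2 * Q := by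
        rw [map_add, map_smul, inner_add_right, inner_add_left, inner_add_left, hx',
          inner_smul_left, hx', inner_smul_right, inner_smul_right, inner_smul_left,
          inner_self_eq_norm_sq_to_K, Complex.conj_ofReal]
        simp only [mul_zero, add_zero, zero_add, Complex.add_re, Complex.re_ofReal_mul]
        have : ((‖J x‖ : ℂ) ^ 2).re = N := by rw [← Complex.ofReal_pow, Complex.ofReal_re]
        erw [this]
        ring
      rw [h2] at h1
      have h3 : N ≤ a * Q := by nlinarith
      have h4 : a * (2 * (Q + 1)) = N := by rw [ha]; field_simp
      nlinarith
    exact hinj (by rw [hz, map_zero])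
  rw [← Submodule.topologicalClosure_eq_top_iff,
    ← Submodule.dense_iff_topologicalClosure_eq_top] at h
  exact h

/-- Uniformly bounded operators that converge on a dense set converge strongly. -/
theorem exists_strong_limit [CompleteSpace H] {ι : Type*} {l : Filter ι} [l.NeBot]
    {T : ι → H →L[ℂ] H} {M : ℝ} (hM : ∀ᶠ i in l, ∀ g, ‖T i g‖ ≤ M * ‖g‖) {D : Set H} (hD : Dense D)
    (hc : ∀ g ∈ D, ∃ a, Tendsto (fun i => T i g) l (𝓝 a)) :
    ∃ S : H →L[ℂ] H, ∀ g, Tendsto (fun i => T i g) l (𝓝 (S g)) := by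
  have hall : ∀ g, ∃ a, Tendsto (fun i => T i g) l (𝓝 a) := by
    intro g
    rw [← cauchy_map_iff_exists_tendsto, Metric.cauchy_iff]
    refine ⟨inferInstance, fun ε hε => ?_⟩
    have hε' : 0 < ε / (4 * (|M| + 1)) := by positivity
    obtain ⟨f, hfD, hf⟩ := Metric.mem_closure_iff.1 (hD g) _ hε'
    obtain ⟨a, ha⟩ := hc f hfD
    have h1 : ∀ᶠ i in l, dist (T i g) a < ε / 2 := by
      filter_upwards [hM, (Metric.tendsto_nhds.1 ha) (ε / 4) (by positivity)] with i hi h2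
      have h3 : dist (T i g) (T i f) < ε / 4 := by
        rw [dist_eq_norm, ← map_sub]
        refine (hi _).trans_lt ?_
        rw [dist_eq_norm] at hf
        calc M * ‖g - f‖ ≤ (|M| + 1) * ‖g - f‖ := by gcongr; linarith [le_abs_self M]
          _ < (|M| + 1) * (ε / (4 * (|M| + 1))) := by gcongr
          _ = ε / 4 := by field_simp
      linarith [dist_triangle (T i g) (T i f) a]
    refine ⟨_, image_mem_map h1, ?_⟩
    rintro _ ⟨i, hi, rfl⟩ _ ⟨j, hj, rfl⟩
    simp only [Set.mem_ofPred_eq] at hi hj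
    linarith [dist_triangle_right (T i g) (T j g) a]
  choose S hS using hall
  refine ⟨LinearMap.mkContinuous ⟨⟨S, fun x y => ?_⟩, fun c x => ?_⟩ M fun x => ?_, hS⟩
  · exact tendsto_nhds_unique (hS _) (by simpa using (hS x).add (hS y))
  · exact tendsto_nhds_unique (hS _) (by simpa using (hS x).const_smul c)
  · exact le_of_tendsto (hS x).norm (hM.mono fun i hi => hi x)

theorem accretive_add_smul_one {J : H →L[ℂ] H} (hJ : Accretive J 0) (δ : ℝ) :
    Accretive (J + (δ : ℂ) • 1) δ := by
  simpa using hJ.add_smul_one (δ : ℂ)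

variable [CompleteSpace H]

/-- Duhamel's estimate: if `w` solves `w' = -B w` up to an error `C`, then it stays within `C t` of
the exact solution with the same initial value. -/
theorem norm_sub_expNeg_apply_le {B : H →L[ℂ] H} (hB : Accretive B 0) {w w' : ℝ → H} {t C : ℝ}
    (ht : 0 ≤ t) (hw : ∀ r ∈ Set.Icc 0 t, HasDerivWithinAt w (w' r) (Set.Icc 0 t) r)
    (hC : ∀ r ∈ Set.Icc 0 t, ‖w' r + B (w r)‖ ≤ C) :
    ‖w t - expNeg B t (w 0)‖ ≤ C * t := by
  let L := ContinuousLinearMap.restrictScalarsL ℂ H H ℝ ℝ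
  have h1 : ∀ r ∈ Set.Icc 0 t, HasDerivWithinAt (fun r => expNeg B (t - r) (w r))
      (expNeg B (t - r) (w' r + B (w r))) (Set.Icc 0 t) r := by
    intro r hr
    have h2 : HasDerivAt (fun r => expNeg B (t - r)) (expNeg B (t - r) * B) r := by
      have := (hasDerivAt_expNeg B (t - r)).scomp r ((hasDerivAt_id r).const_sub t)
      simpa [Function.comp_def] using this
    have h3 : HasDerivAt (fun r => L (expNeg B (t - r))) (L (expNeg B (t - r) * B)) r :=
      L.hasFDerivAt.comp_hasDerivAt r h2
    have h4 := h3.hasDerivWithinAt.clm_apply (hw r hr)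
    rw [map_add, add_comm]
    exact h4
  have h5 := Convex.norm_image_sub_le_of_norm_hasDerivWithin_le (C := C) h1 (fun r hr => ?_)
    (convex_Icc 0 t) (Set.left_mem_Icc.2 ht) (Set.right_mem_Icc.2 ht)
  · simpa [abs_of_nonneg ht] using h5
  · exact (norm_expNeg_apply_le hB (by linarith [hr.2]) _).trans (hC r hr)

theorem norm_expNeg_sub_expNeg_le {B B' : H →L[ℂ] H} (hB : Accretive B 0) (hB' : Accretive B' 0)
    (hc : Commute B B') {t : ℝ} (ht : 0 ≤ t) (x : H) :
    ‖expNeg B' t x - expNeg B t x‖ ≤ ‖(B - B') x‖ * t := by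
  have h := norm_sub_expNeg_apply_le hB (w := fun r => expNeg B' r x) (C := ‖(B - B') x‖) ht
    (fun r _ => (hasDerivAt_expNeg_apply B' x r).hasDerivWithinAt) (fun r hr => ?_)
  · simpa using h
  · have h1 : -(B' (expNeg B' r x)) + B (expNeg B' r x) = expNeg B' r ((B - B') x) := by
      have h2 := (commute_expNeg (hc.sub_left (Commute.refl B')) r).eq
      have h3 := congrArg (fun A : H →L[ℂ] H => A x) h2
      simp only [mul_apply_eq_comp, sub_apply] at h3
      rw [sub_apply, ← h3]; abel
    rw [h1]
    exact norm_expNeg_apply_le hB' hr.1 _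

section Resolvent

variable {J : H →L[ℂ] H} (hJ : Accretive J 0) {δ η : ℝ} (hδ : 0 < δ)
include hJ hδ

theorem commute_inverse {A : H →L[ℂ] H} (h : Commute A J) :
    Commute A (Ring.inverse (J + (δ : ℂ) • 1)) :=
by
  have h1 : Commute A (J + (δ : ℂ) • 1) := h.add_right ((Commute.one_right _).smul_right _)
  obtain ⟨U, hU⟩ := isUnit_of_accretive hδ (accretive_add_smul_one hJ δ)
  rw [← hU] at h1 ⊢
  rw [Ring.inverse_unit]
  exact h1.units_inv_right

theorem inverse_mul_eq :
    Ring.inverse (J + (δ : ℂ) • 1) * J = 1 - (δ : ℂ) • Ring.inverse (J + (δ : ℂ) • 1) := by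
  have h := Ring.inverse_mul_cancel _ (isUnit_of_accretive hδ (accretive_add_smul_one hJ δ))
  rw [mul_add, mul_smul_comm, mul_one] at h
  exact eq_sub_of_add_eq h

theorem norm_smul_inverse_apply_le (x : H) :
    ‖(δ : ℂ) • Ring.inverse (J + (δ : ℂ) • 1) x‖ ≤ ‖x‖ := by
  rw [norm_smul, Complex.norm_real, Real.norm_of_nonneg hδ.le]
  calc _ ≤ δ * (1 / δ * ‖x‖) := by
        gcongr
        exact ContinuousLinearMap.le_of_opNorm_le _
          (norm_inverse_le hδ (accretive_add_smul_one hJ δ)) x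
    _ = _ := by field_simp

/-- The operators `(J + δ)⁻¹ J = 1 - δ (J + δ)⁻¹` are bounded uniformly in `δ`. -/
theorem norm_inverse_apply_le (x : H) : ‖Ring.inverse (J + (δ : ℂ) • 1) (J x)‖ ≤ 2 * ‖x‖ := by
  rw [← mul_apply_eq_comp, inverse_mul_eq hJ hδ, sub_apply, smul_apply, one_apply_eq_self]
  exact (norm_sub_le _ _).trans (by linarith [norm_smul_inverse_apply_le hJ hδ x])

/-- On the range of `J ^ 2` the inverses `(J + δ)⁻¹` are Lipschitz in `δ`, up to `δ = 0`. -/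
theorem norm_inverse_sub_inverse_apply_le (hη : 0 < η) (x : H) :
    ‖(Ring.inverse (J + (δ : ℂ) • 1) - Ring.inverse (J + (η : ℂ) • 1)) (J (J x))‖ ≤
      4 * |δ - η| * ‖x‖ := by
  set Bδ := Ring.inverse (J + (δ : ℂ) • 1)
  set Bη := Ring.inverse (J + (η : ℂ) • 1)
  have h1 : Bδ * (J + (δ : ℂ) • 1) = 1 :=
    Ring.inverse_mul_cancel _ (isUnit_of_accretive hδ (accretive_add_smul_one hJ δ))
  have h2 : (J + (η : ℂ) • 1) * Bη = 1 :=
    Ring.mul_inverse_cancel _ (isUnit_of_accretive hη (accretive_add_smul_one hJ η))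
  have h3 : Bδ - Bη = ((η - δ : ℝ) : ℂ) • (Bδ * Bη) := by
    have : Bδ - Bη = Bδ * ((J + (η : ℂ) • 1) * Bη) - (Bδ * (J + (δ : ℂ) • 1)) * Bη := by
      rw [h1, h2, one_mul, mul_one]
    rw [this]
    simp only [mul_add, add_mul, mul_smul_comm, smul_mul_assoc, mul_one, one_mul, mul_assoc]
    push_cast
    module
  have h4 : Bη * J = J * Bη := (commute_inverse hJ hη (Commute.refl J)).eq.symm
  have h5 : (Bδ - Bη) (J (J x)) = ((η - δ : ℝ) : ℂ) • Bδ (J (Bη (J x))) := by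
    rw [h3, smul_apply, mul_apply_eq_comp, ← mul_apply_eq_comp Bη, h4]; rfl
  rw [h5, norm_smul, Complex.norm_real, Real.norm_eq_abs, abs_sub_comm η]
  calc _ ≤ |δ - η| * (2 * (2 * ‖x‖)) := by
        gcongr
        exact (norm_inverse_apply_le hJ hδ _).trans (by gcongr; exact norm_inverse_apply_le hJ hη _)
    _ = _ := by ring

end Resolvent

theorem accretive_inverse_add_smul_one {J : H →L[ℂ] H} (hJ : Accretive J 0) {δ : ℝ} (hδ : 0 < δ) :
    Accretive (Ring.inverse (J + (δ : ℂ) • 1)) 0 :=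
  let ⟨_, hm, h⟩ := accretive_inverse hδ (accretive_add_smul_one hJ δ)
  h.mono hm.le

/-- The regularized operator `k̂ (∓ i (J + δ)⁻¹)`. -/
noncomputable abbrev regValue (J : H →L[ℂ] H) (s : Side) (k : ℝ → ℝ) (δ : ℝ) : H →L[ℂ] H :=
  cauchyValue s (khat k) (((s.sgn : ℂ) * Complex.I) • Ring.inverse (J + (δ : ℂ) • 1))

section Limit

variable {J : H →L[ℂ] H} (hJ : Accretive J 0) {s : Side} {k : ℝ → ℝ} (hk : Integrable k)
  (hk2 : MemLp k 2) (hk0 : ∀ x, -x ∈ halfLine s → k x = 0)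
include hJ hk hk2 hk0

theorem regValue_apply {δ : ℝ} (hδ : 0 < δ) (g : H) :
    regValue J s k δ g = ∫ x, k x • expNeg (Ring.inverse (J + (δ : ℂ) • 1)) |x| g :=
  let ⟨_, hm, h⟩ := accretive_inverse hδ (accretive_add_smul_one hJ δ)
  cauchyValue_khat_apply hm h s hk hk2 hk0 g

theorem norm_regValue_apply_le {δ : ℝ} (hδ : 0 < δ) (g : H) :
    ‖regValue J s k δ g‖ ≤ (∫ x, |k x|) * ‖g‖ :=
  let ⟨_, hm, h⟩ := accretive_inverse hδ (accretive_add_smul_one hJ δ)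
  norm_cauchyValue_khat_le hm h s hk hk2 hk0 g

theorem regValue_apply_J {δ : ℝ} (hδ : 0 < δ) (g : H) :
    regValue J s k δ (J g) = J (regValue J s k δ g) := by
  have hB := accretive_inverse_add_smul_one hJ hδ
  rw [regValue_apply hJ hk hk2 hk0 hδ, regValue_apply hJ hk hk2 hk0 hδ,
    ← ContinuousLinearMap.integral_comp_comm _ (integrable_smul_expNeg hB hk g)]
  congr 1 with x
  have h := (commute_expNeg (commute_inverse hJ hδ (Commute.refl J)) |x|).eq
  rw [← Complex.coe_smul, ← Complex.coe_smul, map_smul, ← mul_apply_eq_comp J, h]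
  rfl

/-- The regularized operators are bounded by `∫ |k|`, and on the range of `J ^ 2`, which is dense,
they are Lipschitz in `δ`. -/
theorem exists_tendsto_regValue (hk1 : Integrable fun x => |k x| * |x|)
    (hinj : Function.Injective J) :
    ∃ T : H →L[ℂ] H, ∀ g, Tendsto (fun δ => regValue J s k δ g) (𝓝[>] 0) (𝓝 (T g)) := by
  have hd : DenseRange (J ∘ J) := (denseRange_of_accretive hJ hinj).comp
    (denseRange_of_accretive hJ hinj) J.continuous
  refine exists_strong_limit (M := ∫ x, |k x|) (D := Set.range (J ∘ J)) ?_ hd ?_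
  · filter_upwards [self_mem_nhdsWithin] with δ hδ g
    exact norm_regValue_apply_le hJ hk hk2 hk0 hδ g
  · rintro _ ⟨f, rfl⟩
    set K := ∫ x, |k x| * |x|
    have hK : 0 ≤ K := integral_nonneg fun x => by positivity
    have hlip : ∀ δ η : ℝ, 0 < δ → 0 < η → dist (regValue J s k δ (J (J f)))
        (regValue J s k η (J (J f))) ≤ K * (4 * |δ - η| * ‖f‖) := by
      intro δ η hδ hη
      have hBδ := accretive_inverse_add_smul_one hJ hδ
      have hBη := accretive_inverse_add_smul_one hJ hη
      rw [dist_eq_norm, regValue_apply hJ hk hk2 hk0 hδ, regValue_apply hJ hk hk2 hk0 hη,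
        ← integral_sub (integrable_smul_expNeg hBδ hk _) (integrable_smul_expNeg hBη hk _),
        ← integral_mul_const]
      refine norm_integral_le_of_norm_le (hk1.mul_const _) (ae_of_all _ fun x => ?_)
      rw [← smul_sub, norm_smul, Real.norm_eq_abs, mul_assoc, norm_sub_rev]
      have hcm := commute_inverse hJ hη (commute_inverse hJ hδ (Commute.refl J)).symm
      refine mul_le_mul_of_nonneg_left ((norm_expNeg_sub_expNeg_le hBδ hBη hcm
        (abs_nonneg x) _).trans ?_) (abs_nonneg _)
      rw [mul_comm]
      gcongr
      exact norm_inverse_sub_inverse_apply_le hJ hδ hη f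
    rw [← cauchy_map_iff_exists_tendsto, Metric.cauchy_iff]
    refine ⟨inferInstance, fun ε hε => ?_⟩
    have hr : 0 < ε / (4 * K * ‖f‖ + 1) := by positivity
    refine ⟨_, image_mem_map (Ioo_mem_nhdsGT hr), ?_⟩
    rintro _ ⟨δ, hδ, rfl⟩ _ ⟨η, hη, rfl⟩
    have h1 : |δ - η| < ε / (4 * K * ‖f‖ + 1) := by
      rw [abs_lt]; constructor <;> linarith [hδ.1, hδ.2, hη.1, hη.2]
    have h2 := hlip δ η hδ.1 hη.1
    rw [lt_div_iff₀ (by positivity)] at h1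
    refine h2.trans_lt (lt_of_le_of_lt ?_ h1)
    nlinarith [abs_nonneg (δ - η)]

/-- If `u` is bounded and `v = J u` satisfies `v' = -u`, then `u` is the orbit of `u 0` under the
semigroup generated by `-1/J`, and the strong limit maps `u 0` to `∫ k(x) u(|x|) dx`. The identity
is stated after applying `J ^ 2`, where `exp (-t (J + δ)⁻¹)` converges at rate `δ`, and weakly, so
that only scalar integrals occur. -/
theorem inner_J_J_limit_apply (hk1 : Integrable fun x => |k x| * |x|) {T : H →L[ℂ] H}
    (hT : ∀ g, Tendsto (fun δ => regValue J s k δ g) (𝓝[>] 0) (𝓝 (T g)))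
    {u : ℝ → H} {M : ℝ} (hM : ∀ t, ‖u t‖ ≤ M)
    (hu : ∀ t, 0 ≤ t → HasDerivWithinAt (fun t => J (u t)) (-(u t)) (Set.Ici 0) t) :
    ∀ f, inner ℂ f (J (J (T (u 0)))) = ∫ x, (k x : ℂ) * inner ℂ f (J (J (u |x|))) := by
  have hw : ∀ t, 0 ≤ t → HasDerivWithinAt (fun t => J (J (u t))) (-(J (u t))) (Set.Ici 0) t := by
    intro t ht
    have h := ((J.restrictScalars ℝ).hasFDerivAt).comp_hasDerivWithinAt t (hu t ht)
    simpa [Function.comp_def] using h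
  have hcont : Continuous fun x : ℝ => J (J (u |x|)) :=
    ContinuousOn.comp_continuous (f := fun x : ℝ => |x|) (s := Set.Ici 0)
      (fun t ht => (hw t ht).continuousWithinAt) continuous_abs abs_nonneg
  have hint : Integrable (fun x => k x • J (J (u |x|))) := by
    refine (hk.norm.mul_const (‖J‖ * (‖J‖ * M))).mono'
      (hk.aestronglyMeasurable.smul hcont.aestronglyMeasurable) (ae_of_all _ fun x => ?_)
    rw [norm_smul]
    gcongr
    exact J.le_opNorm_of_le (J.le_opNorm_of_le (hM _))
  set K := ∫ x, |k x| * |x|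
  have hest : ∀ δ : ℝ, 0 < δ →
      ‖J (J (regValue J s k δ (u 0))) - ∫ x, k x • J (J (u |x|))‖ ≤ K * (δ * (2 * M)) := by
    intro δ hδ
    have hB := accretive_inverse_add_smul_one hJ hδ
    rw [← regValue_apply_J hJ hk hk2 hk0 hδ, ← regValue_apply_J hJ hk hk2 hk0 hδ,
      regValue_apply hJ hk hk2 hk0 hδ, ← integral_sub (integrable_smul_expNeg hB hk _) hint,
      ← integral_mul_const]
    refine norm_integral_le_of_norm_le (hk1.mul_const _) (ae_of_all _ fun x => ?_)
    rw [← smul_sub, norm_smul, Real.norm_eq_abs, mul_assoc, norm_sub_rev]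
    refine mul_le_mul_of_nonneg_left ?_ (abs_nonneg _)
    rw [mul_comm]
    refine norm_sub_expNeg_apply_le hB (w := fun t => J (J (u t))) (w' := fun t => -(J (u t)))
      (abs_nonneg x) (fun r hr => (hw r hr.1).mono fun y hy => hy.1) fun r _ => ?_
    have h1 : -(J (u r)) + Ring.inverse (J + (δ : ℂ) • 1) (J (J (u r))) =
        -((δ : ℂ) • Ring.inverse (J + (δ : ℂ) • 1) (J (u r))) := by
      rw [← mul_apply_eq_comp, inverse_mul_eq hJ hδ, sub_apply, smul_apply,
        one_apply_eq_self]
      abel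
    rw [h1, norm_neg, norm_smul, Complex.norm_real, Real.norm_of_nonneg hδ.le]
    gcongr
    exact (norm_inverse_apply_le hJ hδ _).trans (by gcongr; exact hM r)
  have hlim1 : Tendsto (fun δ => J (J (regValue J s k δ (u 0)))) (𝓝[>] 0) (𝓝 (J (J (T (u 0))))) :=
    (J.continuous.tendsto _).comp ((J.continuous.tendsto _).comp (hT (u 0)))
  have hlim2 : Tendsto (fun δ => J (J (regValue J s k δ (u 0)))) (𝓝[>] 0)
      (𝓝 (∫ x, k x • J (J (u |x|)))) := by
    rw [tendsto_iff_norm_sub_tendsto_zero]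
    refine squeeze_zero' (Eventually.of_forall fun _ => norm_nonneg _)
      (eventually_nhdsWithin_of_forall hest) ?_
    have : Tendsto (fun δ : ℝ => K * (δ * (2 * M))) (𝓝 0) (𝓝 (K * (0 * (2 * M)))) := by
      apply Continuous.tendsto; fun_prop
    simpa using this.mono_left nhdsWithin_le_nhds
  intro f
  rw [tendsto_nhds_unique hlim1 hlim2, ← integral_inner hint]
  congr 1 with x
  rw [← Complex.coe_smul, inner_smul_right]

end Limit

end StrongLimit

/-! ### Indefinite integration is accretive -/

section Accretive

/-- The reflection `t ↦ ∓ t` reduces integrals over either interval to the interval `(0, β)`. -/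
theorem integral_supp_eq {E : Type*} [NormedAddCommGroup E] [NormedSpace ℝ E]
    (s : Side) (β : EReal) (f : ℝ → E) :
    ∫ t in supp s β, f t = ∫ t in supp .plus β, f (s.sgn * t) := by
  cases s
  · have h := (Measure.measurePreserving_neg (volume : Measure ℝ)).setIntegral_preimage_emb
      (Homeomorph.neg ℝ).measurableEmbedding f (supp .minus β)
    rw [← h]
    have h2 : Neg.neg ⁻¹' supp .minus β = supp .plus β := by
      ext t
      simp [supp, and_comm, EReal.neg_lt_neg_iff]
    rw [h2]
    simp [Side.sgn]
  · simp [Side.sgn]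

theorem indefInt_sgn_mul (s : Side) (g : ℝ → ℂ) (t : ℝ) :
    indefInt s g (s.sgn * t) = ∫ τ in (0 : ℝ)..t, g (s.sgn * τ) := by
  cases s
  · simp only [indefInt, Side.sgn, neg_mul, one_mul]
    rw [intervalIntegral.integral_comp_neg, neg_zero]
  · simp [indefInt, Side.sgn]

open scoped InnerProductSpace in
/-- With `G` the primitive of `g`, the integrand is
`(e^{-2ct} |G| ^ 2)' / 2 + c e^{-2ct} |G| ^ 2`. -/
theorem intervalIntegral_inner_primitive_nonneg {g : ℝ → ℂ} (hg : Continuous g) {c : ℝ}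
    (hc : 0 ≤ c) {b : ℝ} (hb : 0 ≤ b) :
    0 ≤ ∫ t in (0 : ℝ)..b, Real.exp (-(2 * c * t)) * ⟪∫ τ in (0 : ℝ)..t, g τ, g t⟫_ℝ := by
  set G : ℝ → ℂ := fun t => ∫ τ in (0 : ℝ)..t, g τ
  have hG : ∀ t, HasDerivAt G (g t) t := fun t =>
    intervalIntegral.integral_hasDerivAt_right (hg.intervalIntegrable _ _)
      hg.aestronglyMeasurable.stronglyMeasurableAtFilter hg.continuousAt
  have hGc : Continuous G := continuous_iff_continuousAt.2 fun t => (hG t).continuousAt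
  have hd : ∀ t, HasDerivAt (fun t => Real.exp (-(2 * c * t)) * ‖G t‖ ^ 2)
      (2 * (Real.exp (-(2 * c * t)) * ⟪G t, g t⟫_ℝ) -
        2 * c * (Real.exp (-(2 * c * t)) * ‖G t‖ ^ 2)) t := by
    intro t
    have h1 : HasDerivAt (fun r : ℝ => Real.exp (-(2 * c * r)))
        (Real.exp (-(2 * c * t)) * (-(2 * c))) t := by
      simpa using ((hasDerivAt_id t).const_mul (2 * c)).neg.exp
    exact (h1.mul (hG t).norm_sq).congr_deriv (by ring)
  have hc1 : Continuous fun t => Real.exp (-(2 * c * t)) * ⟪G t, g t⟫_ℝ := by fun_prop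
  have hc2 : Continuous fun t => Real.exp (-(2 * c * t)) * ‖G t‖ ^ 2 := by fun_prop
  have h := intervalIntegral.integral_eq_sub_of_hasDerivAt (a := 0) (b := b) (fun t _ => hd t)
    (((hc1.const_mul 2).sub (hc2.const_mul (2 * c))).intervalIntegrable _ _)
  rw [intervalIntegral.integral_sub ((hc1.const_mul _).intervalIntegrable _ _)
    ((hc2.const_mul _).intervalIntegrable _ _), intervalIntegral.integral_const_mul,
    intervalIntegral.integral_const_mul] at h
  have h0 : G 0 = 0 := intervalIntegral.integral_same
  have h3 : 0 ≤ ∫ t in (0 : ℝ)..b, Real.exp (-(2 * c * t)) * ‖G t‖ ^ 2 :=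
    intervalIntegral.integral_nonneg hb fun t _ => by positivity
  have h4 : 0 ≤ Real.exp (-(2 * c * b)) * ‖G b‖ ^ 2 := by positivity
  rw [h0] at h
  simp only [norm_zero, ne_eq, OfNat.ofNat_ne_zero, not_false_eq_true, zero_pow, mul_zero,
    sub_zero] at h
  have h5 := mul_nonneg hc h3
  linarith

theorem integral_supp_nonneg {β : EReal} {r : ℝ → ℝ} (hr : IntegrableOn r (supp .plus β))
    (h : ∀ b, 0 ≤ b → 0 ≤ ∫ t in (0 : ℝ)..b, r t) : 0 ≤ ∫ t in supp .plus β, r t := by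
  induction β with
  | bot => simp [supp]
  | top =>
    have hs : supp .plus ⊤ = Set.Ioi 0 := by ext; simp [supp]
    rw [hs] at hr ⊢
    refine ge_of_tendsto (intervalIntegral_tendsto_integral_Ioi 0 hr tendsto_id) ?_
    filter_upwards [eventually_ge_atTop 0] with b hb using h b hb
  | coe b =>
    have hs : supp .plus b = Set.Ioo 0 b := by ext; simp [supp]
    rw [hs]
    rcases le_total 0 b with hb | hb
    · rw [← integral_Ioc_eq_integral_Ioo, ← intervalIntegral.integral_of_le hb]
      exact h b hb
    · simp [Set.Ioo_eq_empty_of_le hb]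

open scoped InnerProductSpace in
theorem integral_inner_indefInt_nonneg (s : Side) {β : EReal} {c : ℝ} (hc : 0 ≤ c) {g : ℝ → ℂ}
    (hg : Continuous g) :
    0 ≤ ∫ t, ⟪indefInt s g t, g t⟫_ℝ ∂(wMeasure s β c) := by
  rw [wMeasure, integral_withDensity_eq_integral_toReal_smul (measurable_weight c)
    (ae_of_all _ fun _ => ENNReal.ofReal_lt_top)]
  simp only [ENNReal.toReal_ofReal (Real.exp_pos _).le, smul_eq_mul]
  -- arguing by contradiction makes the reflected integrand integrable for free: a non-integrable
  -- function has integral `0`, which is nonnegative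
  by_contra hneg
  rw [integral_supp_eq] at hneg
  have heq : ∀ t ∈ supp .plus β,
      Real.exp (-(2 * c * |s.sgn * t|)) * ⟪indefInt s g (s.sgn * t), g (s.sgn * t)⟫_ℝ =
      Real.exp (-(2 * c * t)) * ⟪∫ τ in (0 : ℝ)..t, g (s.sgn * τ), g (s.sgn * t)⟫_ℝ := by
    intro t ht
    have : |s.sgn * t| = t := by cases s <;> simp [Side.sgn, abs_of_pos ht.1]
    rw [this, indefInt_sgn_mul]
  rw [setIntegral_congr_fun (measurableSet_supp _ _) heq] at hneg
  refine hneg (integral_supp_nonneg ?_ fun b hb =>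
    intervalIntegral_inner_primitive_nonneg (g := fun t => g (s.sgn * t)) (by fun_prop) hc hb)
  by_contra hni
  rw [integral_undef hni] at hneg
  exact hneg le_rfl

open scoped InnerProductSpace in
/-- By density it suffices to consider bounded continuous functions, whose primitives are
continuously differentiable. -/
theorem accretive_J (s : Side) (β : EReal) (c : ℝ) (h : Admissible β c) :
    Accretive (J s β c h) 0 := by
  have := isFiniteMeasure_wMeasure s h
  intro g
  rw [zero_mul]
  have hd := Lp.boundedContinuousFunction_dense ℂ (wMeasure s β c) (p := 2) (by norm_num)
  refine hd.induction (P := fun g => 0 ≤ (inner ℂ (J s β c h g) g).re) ?_ ?_ g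
  · intro f hf
    obtain ⟨φ, hφ⟩ := Lp.mem_boundedContinuousFunction_iff.1 hf
    have hfφ : f =ᵐ[wMeasure s β c] φ := by
      rw [← hφ]; exact ContinuousMap.coeFn_toAEEqFun _ _
    have hae : (fun t => (inner ℂ (J s β c h f t) (f t)).re) =ᵐ[wMeasure s β c]
        fun t => ⟪indefInt s φ t, φ t⟫_ℝ := by
      filter_upwards [J_coeFn s β c h f, hfφ, ae_wMeasure_mem s β c] with t h1 h2 h3
      rw [h1, h2, indefInt_congr hfφ h3]
      rfl
    have hi := L2.integrable_inner (𝕜 := ℂ) (J s β c h f) f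
    rw [L2.inner_def]
    have h4 : (∫ t, inner ℂ (J s β c h f t) (f t) ∂(wMeasure s β c)).re =
        ∫ t, (inner ℂ (J s β c h f t) (f t)).re ∂(wMeasure s β c) := (integral_re hi).symm
    rw [h4, integral_congr_ae hae]
    exact integral_inner_indefInt_nonneg s h.1 φ.continuous
  · exact isClosed_le continuous_const (by fun_prop)

end Accretive

/-! ### Indefinite integration is injective -/

section Injective

theorem isOpen_seg (s : Side) (t : ℝ) : IsOpen (seg s t) := by
  cases s <;> exact isOpen_Ioo

theorem exists_rat_mem_seg {s : Side} {β : EReal} {x : ℝ} (hx : x ∈ supp s β) :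
    ∃ q : ℚ, (q : ℝ) ∈ supp s β ∧ x ∈ seg s q := by
  cases s
  · obtain ⟨q, h1, h2⟩ := EReal.exists_rat_btwn_of_lt hx.1
    have h3 : (q : ℝ) < x := EReal.coe_lt_coe_iff.1 h2
    exact ⟨q, ⟨h1, h3.trans hx.2⟩, h3, hx.2⟩
  · obtain ⟨q, h1, h2⟩ := EReal.exists_rat_btwn_of_lt hx.2
    have h3 : x < (q : ℝ) := EReal.coe_lt_coe_iff.1 h1
    exact ⟨q, ⟨hx.1.trans h3, h2⟩, hx.1, h3⟩

theorem integral_indicator_seg_eq {s : Side} {T x : ℝ} (hx : x ∈ seg s T) (g : ℝ → ℂ) :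
    ∫ τ in (0 : ℝ)..x, (seg s T).indicator g τ = (s.sgn : ℂ) * indefInt s g x := by
  cases s
  · simp only [indefInt, Side.sgn]
    rw [intervalIntegral.integral_symm, intervalIntegral.integral_of_le hx.2.le,
      intervalIntegral.integral_of_le hx.2.le, integral_Ioc_eq_integral_Ioo,
      integral_Ioc_eq_integral_Ioo]
    rw [setIntegral_congr_fun measurableSet_Ioo fun τ hτ => Set.indicator_of_mem (s := seg .minus T)
      (show τ ∈ seg .minus T from ⟨hx.1.trans hτ.1, hτ.2⟩) g]
    simp
  · simp only [indefInt, Side.sgn]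
    rw [intervalIntegral.integral_of_le hx.1.le,
      intervalIntegral.integral_of_le hx.1.le, integral_Ioc_eq_integral_Ioo,
      integral_Ioc_eq_integral_Ioo]
    rw [setIntegral_congr_fun measurableSet_Ioo fun τ hτ => Set.indicator_of_mem (s := seg .plus T)
      (show τ ∈ seg .plus T from ⟨hτ.1, hτ.2.trans hx.2⟩) g]
    simp

/-- An indefinite integral is continuous, so if it vanishes almost everywhere it vanishes
identically, and by Lebesgue's differentiation theorem so does the integrand, almost everywhere.
The integrand is cut off at rational points to make it integrable on the line. -/
theorem ae_eq_zero_of_indefInt_eq_zero {s : Side} {β : EReal} {c : ℝ} {g : ℝ → ℂ}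
    (hg : MemLp g 2 (wMeasure s β c)) (h0 : indefInt s g =ᵐ[wMeasure s β c] 0) :
    g =ᵐ[wMeasure s β c] 0 := by
  rw [Filter.EventuallyEq, ae_wMeasure_iff, ae_restrict_iff' (measurableSet_supp s β)] at h0 ⊢
  have hq : ∀ q : ℚ, ∀ᵐ x, (q : ℝ) ∈ supp s β → x ∈ seg s q → g x = 0 := by
    intro q
    by_cases hqs : (q : ℝ) ∈ supp s β
    swap
    · exact ae_of_all _ fun x h => absurd h hqs
    have hint : Integrable ((seg s q).indicator g) :=
      (integrable_indicator_iff (measurableSet_seg s q)).2 (integrableOn_seg hqs hg)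
    have hcont : Continuous fun x => ∫ τ in (0 : ℝ)..x, (seg s q).indicator g τ :=
      intervalIntegral.continuous_primitive (fun a b => hint.intervalIntegrable) 0
    have hzero : Set.EqOn (fun x => ∫ τ in (0 : ℝ)..x, (seg s q).indicator g τ) (fun _ => 0)
        (seg s q) := by
      refine Measure.eqOn_open_of_ae_eq (μ := volume) ?_ (isOpen_seg s q) hcont.continuousOn
        continuousOn_const
      rw [Filter.EventuallyEq, ae_restrict_iff' (measurableSet_seg s q)]
      filter_upwards [h0] with x hx hxq
      rw [integral_indicator_seg_eq hxq, hx (seg_subset hqs hxq)]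
      simp
    filter_upwards [LocallyIntegrable.ae_hasDerivAt_integral hint.locallyIntegrable] with x hx _ hxq
    have h1 := hx 0
    have h2 : HasDerivAt (fun x => ∫ τ in (0 : ℝ)..x, (seg s q).indicator g τ) 0 x :=
      (hasDerivAt_const x (0 : ℂ)).congr_of_eventuallyEq
        (hzero.eventuallyEq_of_mem ((isOpen_seg s q).mem_nhds hxq))
    simpa [hxq] using h1.unique h2
  filter_upwards [ae_all_iff.2 hq] with x hx hxs
  obtain ⟨q, h1, h2⟩ := exists_rat_mem_seg hxs
  exact hx q h1 h2

theorem injective_J (s : Side) (β : EReal) (c : ℝ) (h : Admissible β c) :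
    Function.Injective (J s β c h) := by
  rw [injective_iff_map_eq_zero]
  intro g hg
  rw [Lp.eq_zero_iff_ae_eq_zero]
  refine ae_eq_zero_of_indefInt_eq_zero (Lp.memLp g) ?_
  have h1 := J_coeFn s β c h g
  rw [hg] at h1
  exact h1.symm.trans (Lp.coeFn_zero _ _ _)

end Injective

/-! ### Integrability of `k` -/

section WeightedSquareIntegrable

variable {s : Side} {ε : ℝ} {k : ℝ → ℝ}

theorem MemL.integrable (hk : MemL s ε k) (hε : 0 < ε) : Integrable k := by
  refine (hk.2.1.add (integrable_exp_neg_mul_abs hε)).mono' hk.1 (ae_of_all _ fun x => ?_)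
  have h : Real.exp (ε * |x|) * Real.exp (-(ε * |x|)) = 1 := by rw [← Real.exp_add]; simp
  have h1 := Real.exp_pos (ε * |x|)
  have h2 := Real.exp_pos (-(ε * |x|))
  simp only [Pi.add_apply, Real.norm_eq_abs]
  -- `|k| = (|k| p ^ (1/2)) (q ^ (1/2)) ≤ |k| ^ 2 p + q` with `p q = 1`
  set p := Real.exp (ε * |x|)
  set q := Real.exp (-(ε * |x|))
  have h3 : |k x| = |k x| * p * q := by rw [mul_assoc, h, mul_one]
  nlinarith [sq_nonneg (|k x| * p - 1), sq_nonneg (|k x| * p), abs_nonneg (k x),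
    mul_nonneg h2.le (sq_nonneg (|k x| * p - 1)),
    mul_nonneg (mul_nonneg (abs_nonneg (k x)) h1.le) h2.le]

theorem MemL.memLp (hk : MemL s ε k) (hε : 0 < ε) : MemLp k 2 := by
  rw [memLp_two_iff_integrable_sq_norm hk.1]
  refine hk.2.1.mono' (hk.1.norm.pow 2) (ae_of_all _ fun x => ?_)
  rw [Real.norm_of_nonneg (by positivity), Real.norm_eq_abs]
  exact le_mul_of_one_le_right (by positivity) (Real.one_le_exp (by positivity))

theorem MemL.integrable_mul_abs (hk : MemL s ε k) (hε : 0 < ε) :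
    Integrable fun x => |k x| * |x| := by
  refine (hk.2.1.add ((integrable_exp_neg_mul_abs (half_pos hε)).const_mul (8 / ε ^ 2))).mono'
    ((continuous_abs.comp_aestronglyMeasurable hk.1).mul continuous_abs.aestronglyMeasurable)
    (ae_of_all _ fun x => ?_)
  have hq := Real.quadratic_le_exp_of_nonneg (x := ε / 2 * |x|) (by positivity)
  have h1 := Real.exp_pos (ε / 2 * |x|)
  have h2 := Real.exp_pos (-(ε / 2 * |x|))
  have h : Real.exp (ε / 2 * |x|) * Real.exp (-(ε / 2 * |x|)) = 1 := by
    rw [← Real.exp_add]; simp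
  have hp : Real.exp (ε * |x|) = Real.exp (ε / 2 * |x|) ^ 2 := by
    rw [← Real.exp_nat_mul]; congr 1; push_cast; ring
  simp only [Pi.add_apply]
  rw [Real.norm_of_nonneg (by positivity), hp]
  set p := Real.exp (ε / 2 * |x|)
  set q := Real.exp (-(ε / 2 * |x|))
  have h4 : |x| ^ 2 ≤ 8 / ε ^ 2 * p := by
    rw [div_mul_eq_mul_div, le_div_iff₀ (by positivity)]
    nlinarith [mul_nonneg hε.le (abs_nonneg x)]
  -- `a b ≤ (a p) ^ 2 + (b q) ^ 2` when `p q = 1`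
  have h5 : |k x| * |x| = (|k x| * p) * (|x| * q) := by
    linear_combination (-(|k x| * |x|)) * h
  have h6 : |x| ^ 2 * q ^ 2 ≤ 8 / ε ^ 2 * q := by
    calc |x| ^ 2 * q ^ 2 ≤ (8 / ε ^ 2 * p) * q ^ 2 := by gcongr
      _ = _ := by linear_combination (8 / ε ^ 2 * q) * h
  nlinarith [sq_nonneg (|k x| * p - |x| * q), sq_nonneg (|k x| * p), sq_nonneg (|x| * q)]

theorem wMeasure_le (s : Side) (β : EReal) {c : ℝ} (hc : 0 ≤ c) : wMeasure s β c ≤ volume := by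
  refine le_trans (withDensity_mono (g := 1) (ae_of_all _ fun t => ?_)) ?_
  · rw [Pi.one_apply, ← ENNReal.ofReal_one]
    refine ENNReal.ofReal_le_ofReal (Real.exp_le_one_iff.2 ?_)
    have := mul_nonneg hc (abs_nonneg t)
    linarith
  · rw [withDensity_one]; exact Measure.restrict_le_self

theorem memLp_wMeasure {k : ℝ → ℝ} (hk : MemLp k 2) (s : Side) (β : EReal) {c : ℝ} (hc : 0 ≤ c) :
    MemLp (fun t => (k t : ℂ)) 2 (wMeasure s β c) :=
  hk.ofReal.mono_measure (wMeasure_le s β hc)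

end WeightedSquareIntegrable

/-! ### Shifting the function `1` -/

section Shift

theorem measurableSet_lt_abs (t : ℝ) : MeasurableSet {x : ℝ | t < |x|} :=
  measurableSet_lt measurable_const measurable_abs

theorem wMeasure_ne_top (s : Side) {β : EReal} {c : ℝ} (h : Admissible β c) (A : Set ℝ) :
    wMeasure s β c A ≠ ∞ :=
  have := isFiniteMeasure_wMeasure s h
  measure_ne_top _ _

/-- The function `1` shifted by `t` away from the origin: the indicator function of the part of the
support where `|x| > t`. -/
noncomputable def shiftOne (s : Side) (β : EReal) (c : ℝ) (h : Admissible β c) (t : ℝ) :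
    HSpace s β c :=
  indicatorConstLp 2 (measurableSet_lt_abs t) (wMeasure_ne_top s h _) 1

variable (s : Side) (β : EReal) (c : ℝ) (h : Admissible β c)

theorem shiftOne_coeFn (t : ℝ) :
    shiftOne s β c h t =ᵐ[wMeasure s β c] {x : ℝ | t < |x|}.indicator fun _ => 1 :=
  indicatorConstLp_coeFn

theorem shiftOne_zero : shiftOne s β c h 0 = one s β c h := by
  refine Lp.ext ?_
  filter_upwards [shiftOne_coeFn s β c h 0, (memLp_one s h).coeFn_toLp, ae_wMeasure_mem s β c]
    with x h1 h2 h3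
  rw [h1, one, h2, Set.indicator_of_mem]
  have h4 := supp_subset_halfLine s β h3
  have : x ≠ 0 := by
    rintro rfl
    cases s <;> simp [halfLine] at h4
  exact abs_pos.2 this

theorem norm_shiftOne_le (t : ℝ) : ‖shiftOne s β c h t‖ ≤ ‖one s β c h‖ := by
  refine Lp.norm_le_norm_of_ae_le ?_
  filter_upwards [shiftOne_coeFn s β c h t, (memLp_one s h).coeFn_toLp] with x h1 h2
  rw [h1, one, h2]
  exact norm_indicator_le_norm_self (fun _ : ℝ => (1 : ℂ)) x

theorem indefInt_indicator_lt_abs {x : ℝ} (hx : x ∈ supp s β) {t : ℝ} (ht : 0 ≤ t) :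
    indefInt s ({x : ℝ | t < |x|}.indicator fun _ => 1) x = (max (|x| - t) 0 : ℝ) := by
  rw [indefInt_eq hx, integral_indicator (measurableSet_lt_abs t),
    Measure.restrict_restrict (measurableSet_lt_abs t), setIntegral_const]
  have h1 : volume.real ({x : ℝ | t < |x|} ∩ seg s x) = max (|x| - t) 0 := by
    cases s
    · have : {x : ℝ | t < |x|} ∩ seg .minus x = Set.Ioo x (-t) := by
        ext y
        simp only [seg, Set.mem_inter_iff, Set.mem_ofPred_eq, Set.mem_Ioo]
        constructor
        · rintro ⟨h1, h2, h3⟩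
          rw [abs_of_neg h3] at h1
          exact ⟨h2, by linarith⟩
        · rintro ⟨h1, h2⟩
          refine ⟨?_, h1, ?_⟩
          · rw [lt_abs]; right; linarith
          · linarith
      rw [this, Real.volume_real_Ioo, abs_of_neg hx.2]
      congr 1; ring
    · have : {x : ℝ | t < |x|} ∩ seg .plus x = Set.Ioo t x := by
        ext y
        simp only [seg, Set.mem_inter_iff, Set.mem_ofPred_eq, Set.mem_Ioo]
        constructor
        · rintro ⟨h1, h2, h3⟩
          rw [abs_of_pos h2] at h1
          exact ⟨h1, h3⟩
        · rintro ⟨h1, h2⟩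
          exact ⟨by rw [lt_abs]; left; exact h1, by linarith, h2⟩
      rw [this, Real.volume_real_Ioo, abs_of_pos hx.1]
  rw [h1]; simp

theorem J_shiftOne_coeFn {t : ℝ} (ht : 0 ≤ t) :
    J s β c h (shiftOne s β c h t) =ᵐ[wMeasure s β c] fun x => ((max (|x| - t) 0 : ℝ) : ℂ) := by
  filter_upwards [J_coeFn s β c h (shiftOne s β c h t), ae_wMeasure_mem s β c] with x h1 hx
  rw [h1, indefInt_congr (shiftOne_coeFn s β c h t) hx, indefInt_indicator_lt_abs s β hx ht]

theorem abs_max_sub_max_add_le (a t t' : ℝ) :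
    |max (a - t') 0 - max (a - t) 0 + (t' - t) * {a : ℝ | t < a}.indicator 1 a| ≤
      |t' - t| * (Set.Icc (min t t') (max t t')).indicator 1 a := by
  by_cases h1 : a ∈ Set.Icc (min t t') (max t t')
  · rw [Set.indicator_of_mem h1, Pi.one_apply, mul_one]
    rcases le_total t t' with htt | htt
    · rw [min_eq_left htt, max_eq_right htt] at h1
      rw [max_eq_right (by linarith [h1.2]), max_eq_left (by linarith [h1.1]),
        abs_of_nonneg (sub_nonneg.2 htt), abs_le]
      by_cases ha : t < a
      · rw [Set.indicator_of_mem (show a ∈ {a : ℝ | t < a} from ha), Pi.one_apply]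
        constructor <;> linarith [h1.1, h1.2]
      · rw [Set.indicator_of_notMem (show a ∉ {a : ℝ | t < a} from ha)]
        constructor <;> linarith [h1.1, h1.2]
    · rw [min_eq_right htt, max_eq_left htt] at h1
      rw [max_eq_left (by linarith [h1.1]), max_eq_right (by linarith [h1.2]),
        Set.indicator_of_notMem (show a ∉ {a : ℝ | t < a} from not_lt.2 h1.2),
        abs_of_nonpos (sub_nonpos.2 htt), abs_le]
      constructor <;> linarith [h1.1, h1.2]
  · rw [Set.indicator_of_notMem h1, mul_zero]
    rcases lt_or_ge a (min t t') with h2 | h2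
    · rw [lt_min_iff] at h2
      rw [max_eq_right (by linarith), max_eq_right (by linarith),
        Set.indicator_of_notMem (show a ∉ {a : ℝ | t < a} from not_lt.2 h2.1.le)]
      simp
    · have h3 : max t t' < a := lt_of_not_ge fun h3 => h1 ⟨h2, h3⟩
      rw [max_lt_iff] at h3
      rw [max_eq_left (by linarith), max_eq_left (by linarith),
        Set.indicator_of_mem (show a ∈ {a : ℝ | t < a} from h3.1), Pi.one_apply]
      rw [show a - t' - (a - t) + (t' - t) * 1 = 0 by ring, abs_zero]

theorem norm_J_shiftOne_sub_le {t t' : ℝ} (ht : 0 ≤ t) (ht' : 0 ≤ t') :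
    ‖J s β c h (shiftOne s β c h t') - J s β c h (shiftOne s β c h t) +
      ((t' - t : ℝ) : ℂ) • shiftOne s β c h t‖ ≤ |t' - t| * Real.sqrt (2 * |t' - t|) := by
  set A : Set ℝ := {x | |x| ∈ Set.Icc (min t t') (max t t')}
  have hA : MeasurableSet A := measurable_abs measurableSet_Icc
  have hsub : A ⊆ Set.Icc (min t t') (max t t') ∪ Set.Icc (-max t t') (-min t t') := by
    intro x hx
    rcases abs_choice x with h1 | h1
    · left; rw [← h1]; exact hx
    · right
      have h2 : |x| ∈ Set.Icc (min t t') (max t t') := hx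
      rw [h1] at h2
      exact ⟨by linarith [h2.2], by linarith [h2.1]⟩
  have hd : max t t' - min t t' = |t' - t| := by rw [max_sub_min_eq_abs']; exact abs_sub_comm _ _
  have hvol : (wMeasure s β c).real A ≤ 2 * |t' - t| := by
    refine ENNReal.toReal_le_of_le_ofReal (by positivity) ?_
    calc wMeasure s β c A ≤ volume A := wMeasure_le s β h.1 A
      _ ≤ volume (Set.Icc (min t t') (max t t')) + volume (Set.Icc (-max t t') (-min t t')) :=
        (measure_mono hsub).trans (measure_union_le _ _)
      _ = ENNReal.ofReal (2 * |t' - t|) := by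
        rw [Real.volume_Icc, Real.volume_Icc, ← ENNReal.ofReal_add (by simp)
          (by simp), ← hd]
        congr 1; ring
  calc _ ≤ ‖(indicatorConstLp 2 hA (wMeasure_ne_top s h A) ((t' - t : ℝ) : ℂ) : HSpace s β c)‖ := by
        refine Lp.norm_le_norm_of_ae_le ?_
        filter_upwards [Lp.coeFn_add (J s β c h (shiftOne s β c h t') -
            J s β c h (shiftOne s β c h t)) (((t' - t : ℝ) : ℂ) • shiftOne s β c h t),
          Lp.coeFn_sub (J s β c h (shiftOne s β c h t')) (J s β c h (shiftOne s β c h t)),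
          Lp.coeFn_smul ((t' - t : ℝ) : ℂ) (shiftOne s β c h t), shiftOne_coeFn s β c h t,
          J_shiftOne_coeFn s β c h ht, J_shiftOne_coeFn s β c h ht',
          indicatorConstLp_coeFn (p := 2) (hs := hA) (hμs := wMeasure_ne_top s h A)
            (c := ((t' - t : ℝ) : ℂ))] with x h1 h2 h3 h4 h5 h6 h7
        rw [h1, Pi.add_apply, h2, Pi.sub_apply, h3, Pi.smul_apply, h4, h5, h6, h7]
        have h8 := abs_max_sub_max_add_le |x| t t'
        have h9 : ({x : ℝ | t < |x|}.indicator (fun _ => (1 : ℂ)) x) =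
            (({a : ℝ | t < a}.indicator 1 |x| : ℝ) : ℂ) := by
          by_cases hx : t < |x| <;> simp [hx]
        have h10 : ‖A.indicator (fun _ => ((t' - t : ℝ) : ℂ)) x‖ =
            |t' - t| * (Set.Icc (min t t') (max t t')).indicator 1 |x| := by
          by_cases hx : |x| ∈ Set.Icc (min t t') (max t t')
          · rw [Set.indicator_of_mem (show x ∈ A from hx), Set.indicator_of_mem hx,
              Complex.norm_real]
            simp
          · rw [Set.indicator_of_notMem (show x ∉ A from hx), Set.indicator_of_notMem hx]
            simp
        rw [h9, h10, smul_eq_mul]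
        norm_cast
    _ = |t' - t| * (wMeasure s β c).real A ^ (1 / (2 : ℝ)) := by
        rw [norm_indicatorConstLp (by norm_num) (by norm_num), Complex.norm_real]
        simp
    _ ≤ _ := by
        rw [Real.sqrt_eq_rpow]
        gcongr

/-- The derivative of `(|x| - t)⁺` in `t` is `-1_{|x| > t}`, in the norm of the Hilbert space. At
`t = 0` it is one-sided: for `t < 0` the shifted function does not depend on `t`. -/
theorem hasDerivWithinAt_J_shiftOne {t : ℝ} (ht : 0 ≤ t) :
    HasDerivWithinAt (fun t => J s β c h (shiftOne s β c h t)) (-shiftOne s β c h t)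
      (Set.Ici 0) t := by
  rw [hasDerivWithinAt_iff_isLittleO]
  have h1 : (fun t' : ℝ => (t' - t) * Real.sqrt (2 * |t' - t|)) =o[𝓝[Set.Ici 0] t]
      fun t' => t' - t := by
    have h2 : Tendsto (fun t' : ℝ => Real.sqrt (2 * |t' - t|)) (𝓝[Set.Ici 0] t) (𝓝 0) := by
      have : Continuous fun t' : ℝ => Real.sqrt (2 * |t' - t|) := by fun_prop
      simpa using (this.tendsto t).mono_left nhdsWithin_le_nhds
    simpa using (Asymptotics.isBigO_refl (fun t' : ℝ => t' - t) _).mul_isLittleO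
      ((Asymptotics.isLittleO_one_iff ℝ).2 h2)
  refine Asymptotics.IsBigO.trans_isLittleO (Asymptotics.IsBigO.of_bound 1 ?_) h1
  filter_upwards [self_mem_nhdsWithin] with t' ht'
  rw [one_mul, smul_neg, sub_neg_eq_add, norm_mul, Real.norm_eq_abs,
    Real.norm_of_nonneg (Real.sqrt_nonneg _),
    ← algebraMap_smul ℂ (t' - t) (shiftOne s β c h t)]
  exact norm_J_shiftOne_sub_le s β c h ht ht'

end Shift

/-! ### The convolution of `k` with `1` -/

section Pairing

variable {s : Side} {β : EReal} {c : ℝ} (h : Admissible β c) {k : ℝ → ℝ}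

theorem integral_indicator_abs_lt (hk0 : ∀ x, -x ∈ halfLine s → k x = 0)
    {τ : ℝ} (hτ : τ ∈ supp s β) :
    ∫ x in {x : ℝ | |x| < |τ|}, (k x : ℂ) = indefInt s (fun x => (k x : ℂ)) τ := by
  rw [indefInt_eq hτ]
  refine setIntegral_eq_of_subset_of_ae_sdiff_eq_zero
    (measurableSet_lt measurable_abs measurable_const).nullMeasurableSet ?_ ?_
  · intro x hx
    cases s
    · change |x| < |τ|
      rw [abs_of_neg hx.2, abs_of_neg hτ.2]; linarith [hx.1]
    · change |x| < |τ|
      rw [abs_of_pos hx.1, abs_of_pos hτ.1]; exact hx.2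
  · filter_upwards [Measure.ae_ne volume (0 : ℝ)] with x hx0 hx
    have h1 : |x| < |τ| := hx.1
    rw [hk0 x, Complex.ofReal_zero]
    cases s
    · simp only [halfLine, Set.mem_Iio]
      rw [abs_of_neg hτ.2, abs_lt] at h1
      by_contra! hcon
      exact hx.2 ⟨by linarith, lt_of_le_of_ne (by linarith) hx0⟩
    · simp only [halfLine, Set.mem_Ioi]
      rw [abs_of_pos hτ.1, abs_lt] at h1
      by_contra! hcon
      exact hx.2 ⟨lt_of_le_of_ne (by linarith) hx0.symm, h1.2⟩

/-- By Fubini's theorem, `∫ k(x) 1_{|x| < |τ|} dx`, the convolution of `k` with `1`, is the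
indefinite integral of `k`; the formula expresses this weakly. -/
theorem integral_mul_inner_shiftOne (hk : Integrable k)
    (hk0 : ∀ x, -x ∈ halfLine s → k x = 0) (hkw : MemLp (fun t => (k t : ℂ)) 2 (wMeasure s β c))
    (f : HSpace s β c) :
    ∫ x, (k x : ℂ) * inner ℂ f (shiftOne s β c h |x|) = inner ℂ f (J s β c h (hkw.toLp _)) := by
  have := isFiniteMeasure_wMeasure s h
  set S : Set (ℝ × ℝ) := {p | |p.1| < |p.2|}
  have hS : MeasurableSet S := measurableSet_lt (by fun_prop) (by fun_prop)
  have hf : Integrable (fun τ => starRingEnd ℂ (f τ)) (wMeasure s β c) :=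
    Complex.conjCLE.toContinuousLinearMap.integrable_comp ((Lp.memLp f).integrable (by norm_num))
  have hprod : Integrable (S.indicator fun p : ℝ × ℝ => (k p.1 : ℂ) * starRingEnd ℂ (f p.2))
      (volume.prod (wMeasure s β c)) := (hk.ofReal.mul_prod hf).indicator hS
  calc ∫ x, (k x : ℂ) * inner ℂ f (shiftOne s β c h |x|)
      = ∫ x, ∫ τ, S.indicator (fun p : ℝ × ℝ => (k p.1 : ℂ) * starRingEnd ℂ (f p.2)) (x, τ)
          ∂(wMeasure s β c) := by
        congr 1 with x
        rw [L2.inner_def, ← integral_const_mul]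
        refine integral_congr_ae ?_
        filter_upwards [shiftOne_coeFn s β c h |x|] with τ h1
        rw [h1]
        by_cases hx : |x| < |τ|
        · rw [Set.indicator_of_mem (show τ ∈ {y : ℝ | |x| < |y|} from hx),
            Set.indicator_of_mem (show (x, τ) ∈ S from hx)]
          simp
        · rw [Set.indicator_of_notMem (show τ ∉ {y : ℝ | |x| < |y|} from hx),
            Set.indicator_of_notMem (show (x, τ) ∉ S from hx)]
          simp
    _ = ∫ τ, (∫ x, S.indicator (fun p : ℝ × ℝ => (k p.1 : ℂ) * starRingEnd ℂ (f p.2)) (x, τ))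
          ∂(wMeasure s β c) := integral_integral_swap (f := fun x τ =>
            S.indicator (fun p : ℝ × ℝ => (k p.1 : ℂ) * starRingEnd ℂ (f p.2)) (x, τ)) hprod
    _ = _ := by
        rw [L2.inner_def]
        refine integral_congr_ae ?_
        filter_upwards [J_coeFn s β c h (hkw.toLp _), ae_wMeasure_mem s β c] with τ h1 hτ
        rw [h1, indefInt_congr hkw.coeFn_toLp hτ, ← integral_indicator_abs_lt hk0 hτ,
          RCLike.inner_apply, ← integral_mul_const,
          ← integral_indicator (measurableSet_lt measurable_abs measurable_const)]
        rfl

end Pairing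

theorem hasDerivAt_indefInt {s : Side} {k : ℝ → ℂ} (hk : Integrable k) {t : ℝ}
    (ht : ContinuousAt k t) : HasDerivAt (indefInt s k) ((s.sgn : ℂ) * k t) t := by
  cases s
  · change HasDerivAt (fun u => ∫ x in u..(0 : ℝ), k x) _ t
    simpa [Side.sgn] using intervalIntegral.integral_hasDerivAt_left (b := 0)
      hk.intervalIntegrable hk.aestronglyMeasurable.stronglyMeasurableAtFilter ht
  · change HasDerivAt (fun u => ∫ x in (0 : ℝ)..u, k x) _ t
    simpa [Side.sgn] using intervalIntegral.integral_hasDerivAt_right (a := 0)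
      hk.intervalIntegrable hk.aestronglyMeasurable.stronglyMeasurableAtFilter ht

end FourierInv

theorem theorem4p2
    (s : FourierInv.Side) (β : EReal) (hβ : 0 < β)
    (c : ℝ) (hc : FourierInv.Admissible β c)
    (ε : ℝ) (hε : 0 < ε) (k : ℝ → ℝ) (hk : FourierInv.MemL s ε k)
    (hk' : ∀ t ∈ FourierInv.halfLine s, DifferentiableAt ℝ k t) :
    Function.Injective (FourierInv.J s β c hc) ∧
    ∃ T : FourierInv.HSpace s β c →L[ℂ] FourierInv.HSpace s β c,
      FourierInv.IsOperatorValue s β c hc (FourierInv.khat k) T ∧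
      (∃ hdom : T (FourierInv.one s β c hc) ∈ (FourierInv.invJ s β c hc).domain,
        FourierInv.invJ s β c hc ⟨T (FourierInv.one s β c hc), hdom⟩
          =ᵐ[FourierInv.wMeasure s β c] fun t => (k t : ℂ)) ∧
      ∃ F : ℝ → ℂ,
        T (FourierInv.one s β c hc) =ᵐ[FourierInv.wMeasure s β c] F ∧
        ∀ t ∈ FourierInv.supp s β,
          DifferentiableAt ℝ F t ∧ (k t : ℂ) = (FourierInv.Side.sgn s : ℂ) * deriv F t := by
  open FourierInv in
  have hinj := injective_J s β c hc
  have hJ := accretive_J s β c hc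
  have hk1 := hk.integrable hε
  have hk2 := hk.memLp hε
  have hkx := hk.integrable_mul_abs hε
  have hkw := memLp_wMeasure hk2 s β hc.1
  obtain ⟨T, hT⟩ := exists_tendsto_regValue hJ hk1 hk2 hk.2.2 hkx hinj
  have hJJ := inner_J_J_limit_apply hJ hk1 hk2 hk.2.2 hkx hT
    (norm_shiftOne_le s β c hc) fun t ht => hasDerivWithinAt_J_shiftOne s β c hc ht
  have hT1 : T (one s β c hc) = J s β c hc (hkw.toLp _) := by
    -- both sides are compared weakly, after applying `𝒥 ^ 2`
    refine hinj (hinj ?_)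
    refine ext_inner_left ℂ fun f => ?_
    rw [← shiftOne_zero, hJJ]
    have h1 : ∀ g, inner ℂ f (J s β c hc (J s β c hc g)) =
        inner ℂ ((J s β c hc).adjoint ((J s β c hc).adjoint f)) g := fun g => by
      rw [ContinuousLinearMap.adjoint_inner_left, ContinuousLinearMap.adjoint_inner_left]
    rw [h1, ← integral_mul_inner_shiftOne hc hk1 hk.2.2 hkw]
    congr 1 with x
    rw [h1]
  refine ⟨hinj, T, ⟨fun δ hδ => ?_, hT⟩, ?_, ?_⟩
  · obtain ⟨m, hm, hB⟩ := accretive_inverse hδ (accretive_add_smul_one hJ δ)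
    exact ⟨isUnit_of_accretive hδ (accretive_add_smul_one hJ δ),
      fun z hz => spectrum_im_pos hm hB s hz, integrable_khat_smul_resolvent hm hB s hk1 hk2⟩
  · have hker : ((J s β c hc).toLinearMap.toPMap ⊤).toFun.ker = ⊥ := by
      rw [LinearMap.ker_eq_bot]
      intro x y hxy
      exact Subtype.ext (hinj hxy)
    have hdom : T (one s β c hc) ∈ (invJ s β c hc).domain := by
      rw [invJ, LinearPMap.inverse_domain]
      exact ⟨⟨hkw.toLp _, trivial⟩, hT1.symm⟩
    refine ⟨hdom, ?_⟩
    have h2 : invJ s β c hc ⟨T (one s β c hc), hdom⟩ = hkw.toLp _ :=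
      LinearPMap.inverse_apply_eq hker (x := ⟨hkw.toLp _, trivial⟩) hT1.symm
    rw [h2]
    exact hkw.coeFn_toLp
  · refine ⟨indefInt s fun t => (k t : ℂ), ?_, fun t ht => ?_⟩
    · rw [hT1]
      filter_upwards [J_coeFn s β c hc (hkw.toLp _), ae_wMeasure_mem s β c] with t h1 h2
      rw [h1, indefInt_congr hkw.coeFn_toLp h2]
    · have hd := hasDerivAt_indefInt (s := s) (k := fun t => (k t : ℂ)) hk1.ofReal (t := t)
        (Complex.continuous_ofReal.continuousAt.comp
          (hk' t (supp_subset_halfLine s β ht)).continuousAt)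
      refine ⟨hd.differentiableAt, ?_⟩
      have hss := s.sgn_mul_sgn
      rw [hd.deriv, ← mul_assoc, hss, one_mul]
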